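/- Let $0<\omega<\tfrac{\alpha}{2}$, and let $(a,b)$ be the solution of $a^2+b^2=1$, $ab=\omega/\alpha$, $0<a<b$. Consider on $\mathbb{R}$ the system \[ u''=F(u,v):=-u(1-u^2-v^2)-v(\omega-\alpha uv),\qquad v''=G(u,v):=-v(1-u^2-v^2)-u(\omega-\alpha uv), \] subject to \[ (u(x),v(x))\to(a,b)\ \text{ as } x\to-\infty,\qquad (u(x),v(x))\to(b,a)\ \text{ as } x\to+\infty . \] Then this problem has a positive solution, i.e. a solution $(u,v)$ of class $C^2$ with $u>0$ and $v>0$ on $\mathbb{R}$. Any two positive solutions are translates of each other: if $(u,v)$ and $(\bar u,\bar v)$ are positive solutions, then there is a constant $T\in\mathbb{R}$ such that $\bar u(x)=u(x+T)$ and $\bar v(x)=v(x+T)$ for all $x\in\mathbb{R}$. Furthermore, every positive solution satisfies $u'>0$ and $v'<0$ on $\mathbb{R}$. -/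

import Mathlib

open Filter Topology

/-- Right-hand side of the first equation: `-u(1-u²-v²) - v(ω-αuv)`. -/
def rhsF (α ω u v : ℝ) : ℝ :=
  -u * (1 - u ^ 2 - v ^ 2) - v * (ω - α * u * v)

/-- Right-hand side of the second equation: `-v(1-u²-v²) - u(ω-αuv)`. -/
def rhsG (α ω u v : ℝ) : ℝ :=
  -v * (1 - u ^ 2 - v ^ 2) - u * (ω - α * u * v)

/-- `(u, v)` is a positive classical (`C²`) solution on the whole line of
`u'' = F(u,v)`, `v'' = G(u,v)` with `(u,v) → (a,b)` at `-∞` and `(u,v) → (b,a)` at `+∞`. -/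
structure IsPositiveHeteroclinic (α ω a b : ℝ) (u v : ℝ → ℝ) : Prop where
  contDiff_u : ContDiff ℝ 2 u
  contDiff_v : ContDiff ℝ 2 v
  eq_u : ∀ x, deriv (deriv u) x = rhsF α ω (u x) (v x)
  eq_v : ∀ x, deriv (deriv v) x = rhsG α ω (u x) (v x)
  pos_u : ∀ x, 0 < u x
  pos_v : ∀ x, 0 < v x
  tendsto_u_atBot : Tendsto u atBot (𝓝 a)
  tendsto_v_atBot : Tendsto v atBot (𝓝 b)
  tendsto_u_atTop : Tendsto u atTop (𝓝 b)
  tendsto_v_atTop : Tendsto v atTop (𝓝 a)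

/-!
Evaluating the equations at extremal points of `u v`, `u + v`, `u - v`, `u` and `v` confines every
positive solution to the box `[a, b]²` and to the region `ω < (2 + α) u v`, where the system is
competitive: `F` is increasing in `v` and `G` in `u`. Two solutions can then be compared in the
order `u' ≤ u`, `v ≤ v'`. Near the wells this comparison is a maximum principle, so that only a
compact interval matters, and a large translate of one solution lies above the other. Sliding it
back until the two touch, uniqueness for the initial value problem makes them equal. Sliding a
solution over itself shows that it is monotone. At a critical point of one component the other one
would be critical too, and the solution would coincide with its own reflection, which the boundary
values exclude.

For existence, the sum and the difference of `u` and `v` solve a pair of cubic equations. With the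
sum written as `c + (S - c) σ`, where `S = a + b` and `(c / 2, c / 2)` is an equilibrium, and the
difference as `(b - a) τ`, the system for an odd `τ` and an even `σ` becomes cooperative whatever
the sign of `α - 2`. Writing `f` for its right-hand side and iterating
`z ↦ (1 - κ⁻² d²/dx²)⁻¹ (z - κ⁻² f(z))` from `(sign, 1)` gives a decreasing sequence on the
half-line; a lower barrier `θ tanh (k x)` keeps its limit away from zero, and the inequality between
the difference and the sum, which the iteration preserves, makes both components positive.
-/

/-! ### Calculus on the line -/

section Calculus

variable {𝕜 F : Type*} [NontriviallyNormedField 𝕜] [NormedAddCommGroup F] [NormedSpace 𝕜 F]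

theorem hasDerivAt_deriv_of_contDiff_two {f : 𝕜 → F} (hf : ContDiff 𝕜 2 f) (x : 𝕜) :
    HasDerivAt (deriv f) (deriv (deriv f) x) x :=
  (hf.differentiable_deriv_two x).hasDerivAt

theorem hasDerivAt_of_contDiff_two {f : 𝕜 → F} (hf : ContDiff 𝕜 2 f) (x : 𝕜) :
    HasDerivAt f (deriv f x) x :=
  (hf.differentiable two_ne_zero x).hasDerivAt

theorem deriv_deriv_add {f g : 𝕜 → F} (hf : ContDiff 𝕜 2 f) (hg : ContDiff 𝕜 2 g) (x : 𝕜) :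
    deriv (deriv fun y => f y + g y) x = deriv (deriv f) x + deriv (deriv g) x := by
  have hderiv : (deriv fun y => f y + g y) = fun y => deriv f y + deriv g y := funext fun y =>
    ((hasDerivAt_of_contDiff_two hf y).add (hasDerivAt_of_contDiff_two hg y)).deriv
  rw [hderiv]
  exact ((hasDerivAt_deriv_of_contDiff_two hf x).add (hasDerivAt_deriv_of_contDiff_two hg x)).deriv

theorem deriv_deriv_sub {f g : 𝕜 → F} (hf : ContDiff 𝕜 2 f) (hg : ContDiff 𝕜 2 g) (x : 𝕜) :
    deriv (deriv fun y => f y - g y) x = deriv (deriv f) x - deriv (deriv g) x := by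
  have hderiv : (deriv fun y => f y - g y) = fun y => deriv f y - deriv g y := funext fun y =>
    ((hasDerivAt_of_contDiff_two hf y).sub (hasDerivAt_of_contDiff_two hg y)).deriv
  rw [hderiv]
  exact ((hasDerivAt_deriv_of_contDiff_two hf x).sub (hasDerivAt_deriv_of_contDiff_two hg x)).deriv

theorem deriv_deriv_mul {f g : 𝕜 → 𝕜} (hf : ContDiff 𝕜 2 f) (hg : ContDiff 𝕜 2 g) (x : 𝕜) :
    deriv (deriv fun y => f y * g y) x =
      deriv (deriv f) x * g x + 2 * (deriv f x * deriv g x) + f x * deriv (deriv g) x := by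
  have hf₁ := hasDerivAt_of_contDiff_two hf
  have hg₁ := hasDerivAt_of_contDiff_two hg
  have hderiv : (deriv fun y => f y * g y) = fun y => deriv f y * g y + f y * deriv g y :=
    funext fun y => ((hf₁ y).mul (hg₁ y)).deriv
  rw [hderiv, (((hasDerivAt_deriv_of_contDiff_two hf x).fun_mul (hg₁ x)).fun_add
    ((hf₁ x).fun_mul (hasDerivAt_deriv_of_contDiff_two hg x))).deriv]
  ring

theorem deriv_deriv_comp_const_sub (f : 𝕜 → F) (c x : 𝕜) :
    deriv (deriv fun y => f (c - y)) x = deriv (deriv f) (c - x) := by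
  have hderiv : (deriv fun y => f (c - y)) = fun y => -deriv f (c - y) :=
    funext fun y => deriv_comp_const_sub f c y
  rw [hderiv, deriv.fun_neg, deriv_comp_const_sub (deriv f), neg_neg]

theorem deriv_deriv_comp_add_const (f : 𝕜 → F) (c x : 𝕜) :
    deriv (deriv fun y => f (y + c)) x = deriv (deriv f) (x + c) := by
  have hderiv : (deriv fun y => f (y + c)) = fun y => deriv f (y + c) :=
    funext fun y => deriv_comp_add_const f c y
  rw [hderiv, deriv_comp_add_const (deriv f)]

end Calculus

theorem deriv_deriv_nonneg_of_isLocalMin {f : ℝ → ℝ} {x : ℝ} (h : IsLocalMin f x)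
    (hf : ContinuousAt f x) : 0 ≤ deriv (deriv f) x := by
  by_contra! hneg
  have hmax : IsLocalMax f x := isLocalMax_of_deriv_deriv_neg hneg h.deriv_eq_zero hf
  have hconst : f =ᶠ[𝓝 x] fun _ => f x := by
    filter_upwards [h, hmax] with y hmin hmax using le_antisymm hmax hmin
  have hzero : deriv (deriv f) x = 0 := by
    simpa only [deriv_const'] using hconst.deriv.deriv_eq
  exact hneg.ne hzero

theorem deriv_deriv_nonpos_of_isLocalMax {f : ℝ → ℝ} {x : ℝ} (h : IsLocalMax f x)
    (hf : ContinuousAt f x) : deriv (deriv f) x ≤ 0 := by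
  have hneg : 0 ≤ deriv (deriv fun y => -f y) x := deriv_deriv_nonneg_of_isLocalMin h.neg hf.neg
  simpa only [deriv.fun_neg', deriv.fun_neg, Left.nonneg_neg_iff] using hneg

theorem mul_mul_deriv_deriv_nonpos_of_isLocalMax_mul_sq {f : ℝ → ℝ} {c x : ℝ}
    (hf : ContDiff ℝ 2 f) (hc : c ≠ 0) (hx : f x ≠ 0)
    (h : IsLocalMax (fun y => c * f y * f y) x) : c * (f x * deriv (deriv f) x) ≤ 0 := by
  have hcf : ContDiff ℝ 2 fun y => c * f y := contDiff_const.mul hf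
  have hcf₁ : deriv (fun y => c * f y) = fun y => c * deriv f y := deriv_const_mul_field' c
  have hcrit : deriv f x = 0 := by
    have hzero := h.hasDerivAt_eq_zero
      ((hasDerivAt_of_contDiff_two hcf x).mul (hasDerivAt_of_contDiff_two hf x))
    rw [hcf₁] at hzero
    have : (2 * c * f x) * deriv f x = 0 := by linear_combination hzero
    exact (mul_eq_zero.1 this).resolve_left (mul_ne_zero (mul_ne_zero two_ne_zero hc) hx)
  have hle := deriv_deriv_nonpos_of_isLocalMax h (hcf.mul hf).continuous.continuousAt
  rw [deriv_deriv_mul hcf hf, hcf₁, deriv_const_mul_field, hcrit] at hle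
  linarith

section Extrema

variable {R : Type*} [LinearOrder R] [TopologicalSpace R] [OrderTopology R]

theorem exists_forall_le_of_tendsto {f : ℝ → R} (hf : Continuous f) {l m : R} {x₀ : ℝ}
    (hbot : Tendsto f atBot (𝓝 l)) (htop : Tendsto f atTop (𝓝 m)) (hl : f x₀ < l)
    (hm : f x₀ < m) : ∃ x, ∀ y, f x ≤ f y := by
  refine hf.exists_forall_le' x₀ ?_
  rw [cocompact_eq_atBot_atTop, eventually_sup]
  exact ⟨(hbot.eventually_const_lt hl).mono fun _ => le_of_lt,
    (htop.eventually_const_lt hm).mono fun _ => le_of_lt⟩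

theorem exists_forall_ge_of_tendsto {f : ℝ → R} (hf : Continuous f) {l m : R} {x₀ : ℝ}
    (hbot : Tendsto f atBot (𝓝 l)) (htop : Tendsto f atTop (𝓝 m)) (hl : l < f x₀)
    (hm : m < f x₀) : ∃ x, ∀ y, f y ≤ f x :=
  exists_forall_le_of_tendsto (R := Rᵒᵈ) hf hbot htop hl hm

theorem exists_forall_le_Iic_of_tendsto {f : ℝ → R} (hf : Continuous f) {l : R} {x₀ x₁ : ℝ}
    (hbot : Tendsto f atBot (𝓝 l)) (hl : f x₀ < l) (hx : x₀ ≤ x₁) :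
    ∃ x ≤ x₁, ∀ y ≤ x₁, f x ≤ f y := by
  have hfar : ∀ᶠ x in cocompact ℝ ⊓ 𝓟 (Set.Iic x₁), f x₀ ≤ f x := by
    rw [cocompact_eq_atBot_atTop, inf_sup_right, (disjoint_atTop_principal_Iic x₁).eq_bot,
      sup_bot_eq]
    exact ((hbot.eventually_const_lt hl).mono fun _ => le_of_lt).filter_mono inf_le_left
  exact hf.continuousOn.exists_isMinOn' isClosed_Iic hx hfar

end Extrema

theorem ODE_solution_unique_of_deriv_deriv_eq {E : Type*} [NormedAddCommGroup E]
    [NormedSpace ℝ E] {f : E → E} {s : Set E} {K : NNReal} (hf : LipschitzOnWith K f s)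
    {w z w' z' : ℝ → E} {x₀ : ℝ}
    (hw : ∀ x, HasDerivAt w (w' x) x) (hw' : ∀ x, HasDerivAt w' (f (w x)) x) (hws : ∀ x, w x ∈ s)
    (hz : ∀ x, HasDerivAt z (z' x) x) (hz' : ∀ x, HasDerivAt z' (f (z x)) x) (hzs : ∀ x, z x ∈ s)
    (h₀ : w x₀ = z x₀) (h₁ : w' x₀ = z' x₀) : w = z := by
  have hfield : LipschitzOnWith (max 1 (K * 1)) (fun p : E × E => (p.2, f p.1))
      (s ×ˢ Set.univ) :=
    LipschitzWith.prod_snd.lipschitzOnWith.prodMk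
      (hf.comp LipschitzWith.prod_fst.lipschitzOnWith fun _ hp => hp.1)
  have heq := ODE_solution_unique_univ (v := fun _ p => (p.2, f p.1)) (s := fun _ => s ×ˢ Set.univ)
    (fun _ => hfield) (f := fun x => (w x, w' x)) (g := fun x => (z x, z' x))
    (fun x => ⟨(hw x).prodMk (hw' x), hws x, trivial⟩)
    (fun x => ⟨(hz x).prodMk (hz' x), hzs x, trivial⟩) (Prod.ext h₀ h₁)
  exact funext fun x => congrArg Prod.fst (congrFun heq x)

/-! ### A priori bounds -/

/-- The points `(a, b)` and `(b, a)` are the wells of the system: they are its equilibria in the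
open quadrant off the diagonal. -/
structure IsWellPair (α ω a b : ℝ) : Prop where
  omega_pos : 0 < ω
  sq_add_sq : a ^ 2 + b ^ 2 = 1
  mul_eq : α * (a * b) = ω
  pos : 0 < a
  lt : a < b

namespace IsWellPair

variable {α ω a b : ℝ}

theorem alpha_pos (hw : IsWellPair α ω a b) : 0 < α :=
  pos_of_mul_pos_left (hw.mul_eq ▸ hw.omega_pos) (mul_pos hw.pos (hw.pos.trans hw.lt)).le

end IsWellPair

theorem rhsG_eq_rhsF (α ω u v : ℝ) : rhsG α ω u v = rhsF α ω v u := by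
  simp only [rhsF, rhsG]
  ring

theorem rhsF_neg_of_lt {α ω a b u v : ℝ} (hα : 0 < α) (hsq : a ^ 2 + b ^ 2 = 1)
    (hmul : α * (a * b) = ω) (hu : 0 < u) (hv : 0 < v) (hua : u < a) (hvb : v < b) :
    rhsF α ω u v < 0 := by
  have hnorm : u ^ 2 + v ^ 2 < 1 := by nlinarith
  have hprod : α * (u * v) < ω := by
    rw [← hmul]
    gcongr
  unfold rhsF
  nlinarith [mul_pos hu (sub_pos.2 hnorm), mul_pos hv (sub_pos.2 hprod)]

theorem rhsF_pos_of_lt {α ω a b u v : ℝ} (hα : 0 < α) (hsq : a ^ 2 + b ^ 2 = 1)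
    (hmul : α * (a * b) = ω) (ha : 0 < a) (hb : 0 < b) (hau : a < u) (hbv : b < v) :
    0 < rhsF α ω u v := by
  have hnorm : 1 < u ^ 2 + v ^ 2 := by nlinarith
  have hprod : ω < α * (u * v) := by
    rw [← hmul]
    gcongr
  unfold rhsF
  nlinarith [mul_pos (ha.trans hau) (sub_pos.2 hnorm), mul_pos (hb.trans hbv) (sub_pos.2 hprod)]

/-- The cubic `p (A (p² - P²) + B (q² - Q²))`. With `A = (2 + α) / 4` and `B = (2 - α) / 4`, the
sum `u + v` and the difference `u - v` solve a pair of equations with such right-hand sides. -/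
def modeRhs (A B P Q p q : ℝ) : ℝ :=
  p * (A * (p ^ 2 - P ^ 2) + B * (q ^ 2 - Q ^ 2))

theorem IsWellPair.rhsF_add_rhsG {α ω a b : ℝ} (hw : IsWellPair α ω a b) (u v : ℝ) :
    rhsF α ω u v + rhsG α ω u v =
      modeRhs ((2 + α) / 4) ((2 - α) / 4) (a + b) (b - a) (u + v) (u - v) := by
  simp only [rhsF, rhsG, modeRhs]
  linear_combination (u + v) * (hw.sq_add_sq + hw.mul_eq)

theorem IsWellPair.rhsF_sub_rhsG {α ω a b : ℝ} (hw : IsWellPair α ω a b) (u v : ℝ) :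
    rhsF α ω u v - rhsG α ω u v =
      modeRhs ((2 + α) / 4) ((2 - α) / 4) (b - a) (a + b) (u - v) (u + v) := by
  simp only [rhsF, rhsG, modeRhs]
  linear_combination (u - v) * (hw.sq_add_sq - hw.mul_eq)

section Mode

variable {A B P Q : ℝ} {p q : ℝ → ℝ}

theorem mul_modeRhs_factor_nonpos_of_isLocalMax {c x : ℝ} (hp : ContDiff ℝ 2 p)
    (heq : deriv (deriv p) x = modeRhs A B P Q (p x) (q x)) (hc : c ≠ 0) (hx : p x ≠ 0)
    (hmax : IsLocalMax (fun y => c * p y * p y) x) :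
    c * (A * (p x ^ 2 - P ^ 2) + B * (q x ^ 2 - Q ^ 2)) ≤ 0 := by
  have hle := mul_mul_deriv_deriv_nonpos_of_isLocalMax_mul_sq hp hc hx hmax
  rw [heq, modeRhs] at hle
  refine nonpos_of_mul_nonpos_right (a := p x ^ 2) ?_ (by positivity)
  linarith

theorem mul_sq_sub_sq_le_of_modeRhs (hA : 0 < A) (hp : ContDiff ℝ 2 p)
    (heq : ∀ x, deriv (deriv p) x = modeRhs A B P Q (p x) (q x)) (hp₀ : ∀ x, p x ≠ 0)
    (hbot : Tendsto p atBot (𝓝 P)) (htop : Tendsto p atTop (𝓝 P)) {c M : ℝ} (hc : c ≠ 0)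
    (hM : 0 ≤ M) (hq : ∀ x, -(c * (B * (q x ^ 2 - Q ^ 2))) ≤ M) (x : ℝ) :
    c * (A * (p x ^ 2 - P ^ 2)) ≤ M := by
  by_contra! hlt
  have hbeyond : c * P * P < c * p x * p x := by
    have : 0 < A * (c * (p x ^ 2 - P ^ 2)) := by linarith
    linarith [pos_of_mul_pos_right this hA.le]
  have hlim {l : Filter ℝ} (hl : Tendsto p l (𝓝 P)) :
      Tendsto (fun y => c * p y * p y) l (𝓝 (c * P * P)) := (hl.const_mul c).mul hl
  obtain ⟨y, hy⟩ := exists_forall_ge_of_tendsto ((hp.continuous.const_mul c).mul hp.continuous)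
    (hlim hbot) (hlim htop) hbeyond hbeyond
  have hmax := mul_modeRhs_factor_nonpos_of_isLocalMax hp (heq y) hc (hp₀ y)
    (Eventually.of_forall hy)
  have hxy : A * (c * p x * p x) ≤ A * (c * p y * p y) := mul_le_mul_of_nonneg_left (hy x) hA.le
  linarith [hq y]

end Mode

theorem deriv_deriv_comp_neg (f : ℝ → ℝ) (x : ℝ) :
    deriv (deriv fun y => f (-y)) x = deriv (deriv f) (-x) := by
  simpa only [zero_sub] using deriv_deriv_comp_const_sub f 0 x

namespace IsPositiveHeteroclinic

variable {α ω a b : ℝ} {u v : ℝ → ℝ}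

theorem reflect (h : IsPositiveHeteroclinic α ω a b u v) :
    IsPositiveHeteroclinic α ω a b (fun x => v (-x)) (fun x => u (-x)) where
  contDiff_u := h.contDiff_v.comp contDiff_neg
  contDiff_v := h.contDiff_u.comp contDiff_neg
  eq_u x := by rw [deriv_deriv_comp_neg, h.eq_v, rhsG_eq_rhsF]
  eq_v x := by rw [deriv_deriv_comp_neg, h.eq_u, rhsG_eq_rhsF]
  pos_u x := h.pos_v _
  pos_v x := h.pos_u _
  tendsto_u_atBot := h.tendsto_v_atTop.comp tendsto_neg_atBot_atTop
  tendsto_v_atBot := h.tendsto_u_atTop.comp tendsto_neg_atBot_atTop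
  tendsto_u_atTop := h.tendsto_v_atBot.comp tendsto_neg_atTop_atBot
  tendsto_v_atTop := h.tendsto_u_atBot.comp tendsto_neg_atTop_atBot

theorem omega_lt_mul (h : IsPositiveHeteroclinic α ω a b u v) (hw : IsWellPair α ω a b) (x : ℝ) :
    ω < (2 + α) * (u x * v x) := by
  have hα := hw.alpha_pos
  by_contra! hx
  have hlt : u x * v x < a * b := by
    have hab : 0 < a * b := mul_pos hw.pos (hw.pos.trans hw.lt)
    nlinarith [hw.mul_eq]
  obtain ⟨y, hmin⟩ := exists_forall_le_of_tendsto
    (h.contDiff_u.continuous.mul h.contDiff_v.continuous)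
    (h.tendsto_u_atBot.mul h.tendsto_v_atBot)
    (h.tendsto_u_atTop.mul h.tendsto_v_atTop) hlt (by rwa [mul_comm b])
  have hloc : IsLocalMin (fun x => u x * v x) y := Eventually.of_forall hmin
  have hcrit : deriv u y * v y + u y * deriv v y = 0 := hloc.hasDerivAt_eq_zero
    ((hasDerivAt_of_contDiff_two h.contDiff_u y).mul (hasDerivAt_of_contDiff_two h.contDiff_v y))
  have hconvex := deriv_deriv_nonneg_of_isLocalMin hloc
    (h.contDiff_u.continuous.mul h.contDiff_v.continuous).continuousAt
  rw [deriv_deriv_mul h.contDiff_u h.contDiff_v, h.eq_u, h.eq_v, rhsF, rhsG] at hconvex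
  have huv : 0 < u y * v y := mul_pos (h.pos_u y) (h.pos_v y)
  have hslopes : deriv u y * deriv v y ≤ 0 := by
    refine nonpos_of_mul_nonpos_left (b := u y * v y) ?_ huv
    calc deriv u y * deriv v y * (u y * v y) = (deriv u y * v y) * (u y * deriv v y) := by ring
      _ = -(u y * deriv v y) ^ 2 := by rw [eq_neg_of_add_eq_zero_left hcrit]; ring
      _ ≤ 0 := neg_nonpos.2 (sq_nonneg _)
  have hgap : (u y ^ 2 + v y ^ 2) * ((2 + α) * (u y * v y) - ω) ≤ 0 := by
    have : (2 + α) * (u y * v y) ≤ (2 + α) * (u x * v x) :=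
      mul_le_mul_of_nonneg_left (hmin x) (by linarith)
    exact mul_nonpos_of_nonneg_of_nonpos (by positivity) (by linarith)
  linarith

theorem deriv_deriv_sum (h : IsPositiveHeteroclinic α ω a b u v) (hw : IsWellPair α ω a b)
    (x : ℝ) : deriv (deriv fun y => u y + v y) x =
      modeRhs ((2 + α) / 4) ((2 - α) / 4) (a + b) (b - a) (u x + v x) (u x - v x) := by
  rw [deriv_deriv_add h.contDiff_u h.contDiff_v, h.eq_u, h.eq_v, hw.rhsF_add_rhsG]

theorem deriv_deriv_diff (h : IsPositiveHeteroclinic α ω a b u v) (hw : IsWellPair α ω a b)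
    (x : ℝ) : deriv (deriv fun y => u y - v y) x =
      modeRhs ((2 + α) / 4) ((2 - α) / 4) (b - a) (a + b) (u x - v x) (u x + v x) := by
  rw [deriv_deriv_sub h.contDiff_u h.contDiff_v, h.eq_u, h.eq_v, hw.rhsF_sub_rhsG]

theorem mul_sq_sum_sub_sq_le (h : IsPositiveHeteroclinic α ω a b u v) (hw : IsWellPair α ω a b)
    {c M : ℝ} (hc : c ≠ 0) (hM : 0 ≤ M)
    (hdiff : ∀ x, -(c * ((2 - α) / 4 * ((u x - v x) ^ 2 - (b - a) ^ 2))) ≤ M) (x : ℝ) :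
    c * ((2 + α) / 4 * ((u x + v x) ^ 2 - (a + b) ^ 2)) ≤ M :=
  mul_sq_sub_sq_le_of_modeRhs (by linarith [hw.alpha_pos]) (h.contDiff_u.add h.contDiff_v)
    (h.deriv_deriv_sum hw) (fun x => (add_pos (h.pos_u x) (h.pos_v x)).ne')
    (h.tendsto_u_atBot.add h.tendsto_v_atBot)
    (by simpa only [add_comm b a] using h.tendsto_u_atTop.add h.tendsto_v_atTop) hc hM hdiff x

theorem sq_diff_le (h : IsPositiveHeteroclinic α ω a b u v) (hw : IsWellPair α ω a b) (x : ℝ) :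
    (u x - v x) ^ 2 ≤ (b - a) ^ 2 := by
  by_contra! hlt
  have hα := hw.alpha_pos
  have hcont : Continuous fun y => u y - v y := h.contDiff_u.continuous.sub h.contDiff_v.continuous
  obtain ⟨y, hmax⟩ := exists_forall_ge_of_tendsto (f := fun y => (u y - v y) ^ 2) (hcont.pow 2)
    ((h.tendsto_u_atBot.sub h.tendsto_v_atBot).pow 2)
    ((h.tendsto_u_atTop.sub h.tendsto_v_atTop).pow 2) (by rwa [sub_sq_comm]) hlt
  set M : ℝ := (u y - v y) ^ 2 - (b - a) ^ 2
  have hM : 0 < M := sub_pos.2 (hlt.trans_le (hmax x))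
  have hne : u y - v y ≠ 0 := by
    intro hzero
    nlinarith [hlt.trans_le (hmax x), sq_nonneg (b - a)]
  have hpeak := mul_modeRhs_factor_nonpos_of_isLocalMax (q := fun x => u x + v x)
    (h.contDiff_u.sub h.contDiff_v) (h.deriv_deriv_diff hw y) one_ne_zero hne
    (Eventually.of_forall fun z => by simpa only [one_mul, ← sq] using hmax z)
  have hB : -((2 - α) / 4) ≠ 0 := by
    intro hzero
    rw [neg_eq_zero.1 hzero] at hpeak
    nlinarith
  have hsum := h.mul_sq_sum_sub_sq_le hw hB (M := ((2 - α) / 4) ^ 2 * M) (by positivity)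
    (fun z => by nlinarith [hmax z, sq_nonneg ((2 - α) / 4)]) y
  nlinarith

theorem abs_diff_le (h : IsPositiveHeteroclinic α ω a b u v) (hw : IsWellPair α ω a b) (x : ℝ) :
    |u x - v x| ≤ b - a :=
  abs_le_of_sq_le_sq (h.sq_diff_le hw x) (sub_pos.2 hw.lt).le

theorem le_u (h : IsPositiveHeteroclinic α ω a b u v) (hw : IsWellPair α ω a b) (x : ℝ) :
    a ≤ u x := by
  by_contra! hlt
  obtain ⟨y, hmin⟩ := exists_forall_le_of_tendsto h.contDiff_u.continuous
    h.tendsto_u_atBot h.tendsto_u_atTop hlt (hlt.trans hw.lt)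
  have hua : u y < a := (hmin x).trans_lt hlt
  have hvb : v y < b := by linarith [(abs_le.1 (h.abs_diff_le hw y)).1]
  have hconvex := deriv_deriv_nonneg_of_isLocalMin (Eventually.of_forall hmin)
    h.contDiff_u.continuous.continuousAt
  rw [h.eq_u] at hconvex
  exact hconvex.not_gt
    (rhsF_neg_of_lt hw.alpha_pos hw.sq_add_sq hw.mul_eq (h.pos_u y) (h.pos_v y) hua hvb)

theorem v_le (h : IsPositiveHeteroclinic α ω a b u v) (hw : IsWellPair α ω a b) (x : ℝ) :
    v x ≤ b := by
  by_contra! hlt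
  obtain ⟨y, hmax⟩ := exists_forall_ge_of_tendsto h.contDiff_v.continuous
    h.tendsto_v_atBot h.tendsto_v_atTop hlt (hw.lt.trans hlt)
  have hbv : b < v y := hlt.trans_le (hmax x)
  have hau : a < u y := by linarith [(abs_le.1 (h.abs_diff_le hw y)).1]
  have hconcave := deriv_deriv_nonpos_of_isLocalMax (Eventually.of_forall hmax)
    h.contDiff_v.continuous.continuousAt
  rw [h.eq_v, rhsG_eq_rhsF] at hconcave
  exact hconcave.not_gt (rhsF_pos_of_lt hw.alpha_pos (by rw [add_comm, hw.sq_add_sq])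
    (by rw [mul_comm b, hw.mul_eq]) (hw.pos.trans hw.lt) hw.pos hbv hau)

end IsPositiveHeteroclinic

/-- Solutions on the line with values in the box `[a, b]²` and in the region where the system is
competitive. -/
structure IsBoxSolution (α ω a b : ℝ) (u v : ℝ → ℝ) : Prop where
  contDiff_u : ContDiff ℝ 2 u
  contDiff_v : ContDiff ℝ 2 v
  eq_u : ∀ x, deriv (deriv u) x = rhsF α ω (u x) (v x)
  eq_v : ∀ x, deriv (deriv v) x = rhsF α ω (v x) (u x)
  mem_u : ∀ x, u x ∈ Set.Icc a b
  mem_v : ∀ x, v x ∈ Set.Icc a b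
  omega_lt_mul : ∀ x, ω < (2 + α) * (u x * v x)

theorem IsPositiveHeteroclinic.isBoxSolution {α ω a b : ℝ} {u v : ℝ → ℝ}
    (h : IsPositiveHeteroclinic α ω a b u v) (hw : IsWellPair α ω a b) :
    IsBoxSolution α ω a b u v where
  contDiff_u := h.contDiff_u
  contDiff_v := h.contDiff_v
  eq_u := h.eq_u
  eq_v x := by rw [h.eq_v, rhsG_eq_rhsF]
  mem_u x := ⟨h.le_u hw x, by simpa only [neg_neg] using h.reflect.v_le hw (-x)⟩
  mem_v x := ⟨by simpa only [neg_neg] using h.reflect.le_u hw (-x), h.v_le hw x⟩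
  omega_lt_mul := h.omega_lt_mul hw

theorem rhsF_lt_rhsF {α ω u v₁ v₂ : ℝ} (hα : 0 ≤ α) (hu : 0 < u) (hv : 0 ≤ v₁) (h : v₁ < v₂)
    (hω : ω < (2 + α) * (u * v₁)) : rhsF α ω u v₁ < rhsF α ω u v₂ := by
  have hdiff : rhsF α ω u v₂ - rhsF α ω u v₁ = (v₂ - v₁) * ((1 + α) * (u * (v₁ + v₂)) - ω) := by
    simp only [rhsF]
    ring
  have hgap : (2 + α) * (u * v₁) ≤ (1 + α) * (u * (v₁ + v₂)) := by
    have hstep : (1 + α) * (u * (2 * v₁)) ≤ (1 + α) * (u * (v₁ + v₂)) := by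
      gcongr
      linarith
    linarith [mul_nonneg hα (mul_nonneg hu.le hv)]
  exact sub_pos.1 (hdiff ▸ mul_pos (sub_pos.2 h) (by linarith))

theorem rhsF_le_rhsF {α ω u v₁ v₂ : ℝ} (hα : 0 ≤ α) (hu : 0 < u) (hv : 0 ≤ v₁) (h : v₁ ≤ v₂)
    (hω : ω < (2 + α) * (u * v₁)) : rhsF α ω u v₁ ≤ rhsF α ω u v₂ :=
  h.eq_or_lt.elim (fun h => h ▸ le_rfl) fun h => (rhsF_lt_rhsF hα hu hv h hω).le

theorem exists_lipschitzOnWith_rhsF_swap {α ω : ℝ} {s : Set (ℝ × ℝ)} (hs : IsCompact s) :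
    ∃ K, LipschitzOnWith K (fun p : ℝ × ℝ => (rhsF α ω p.1 p.2, rhsF α ω p.2 p.1)) s := by
  have hsmooth : ContDiff ℝ 1 fun p : ℝ × ℝ => (rhsF α ω p.1 p.2, rhsF α ω p.2 p.1) := by
    unfold rhsF
    fun_prop
  exact hsmooth.locallyLipschitz.locallyLipschitzOn.exists_lipschitzOnWith_of_compact hs

theorem deriv_eq_of_le_of_eq {f g : ℝ → ℝ} {x : ℝ} (hf : DifferentiableAt ℝ f x)
    (hg : DifferentiableAt ℝ g x) (hle : ∀ y, f y ≤ g y) (h : f x = g x) :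
    deriv f x = deriv g x := by
  have hmin : IsLocalMin (fun y => g y - f y) x := Eventually.of_forall fun y => by
    simpa only [h, sub_self, sub_nonneg] using hle y
  exact (sub_eq_zero.1 (hmin.hasDerivAt_eq_zero (hg.hasDerivAt.sub hf.hasDerivAt))).symm

theorem deriv_deriv_le_of_le_of_eq {f g : ℝ → ℝ} {x : ℝ} (hf : ContDiff ℝ 2 f)
    (hg : ContDiff ℝ 2 g) (hle : ∀ y, f y ≤ g y) (h : f x = g x) :
    deriv (deriv f) x ≤ deriv (deriv g) x := by
  have hmin : IsLocalMin (fun y => g y - f y) x := Eventually.of_forall fun y => by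
    simpa only [h, sub_self, sub_nonneg] using hle y
  have hconvex :=
    deriv_deriv_nonneg_of_isLocalMin hmin (hg.continuous.sub hf.continuous).continuousAt
  rwa [deriv_deriv_sub hg hf, sub_nonneg] at hconvex

namespace IsBoxSolution

variable {α ω a b : ℝ} {u v u' v' : ℝ → ℝ}

theorem swap (h : IsBoxSolution α ω a b u v) : IsBoxSolution α ω a b v u where
  contDiff_u := h.contDiff_v
  contDiff_v := h.contDiff_u
  eq_u := h.eq_v
  eq_v := h.eq_u
  mem_u := h.mem_v
  mem_v := h.mem_u
  omega_lt_mul x := by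
    rw [mul_comm (v x)]
    exact h.omega_lt_mul x

theorem comp_const_sub (h : IsBoxSolution α ω a b u v) (c : ℝ) :
    IsBoxSolution α ω a b (fun x => u (c - x)) (fun x => v (c - x)) where
  contDiff_u := h.contDiff_u.comp (contDiff_const.sub contDiff_id)
  contDiff_v := h.contDiff_v.comp (contDiff_const.sub contDiff_id)
  eq_u x := by rw [deriv_deriv_comp_const_sub, h.eq_u]
  eq_v x := by rw [deriv_deriv_comp_const_sub, h.eq_v]
  mem_u _ := h.mem_u _
  mem_v _ := h.mem_v _
  omega_lt_mul _ := h.omega_lt_mul _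

theorem comp_add_const (h : IsBoxSolution α ω a b u v) (T : ℝ) :
    IsBoxSolution α ω a b (fun x => u (x + T)) (fun x => v (x + T)) where
  contDiff_u := h.contDiff_u.comp (contDiff_id.add contDiff_const)
  contDiff_v := h.contDiff_v.comp (contDiff_id.add contDiff_const)
  eq_u x := by rw [deriv_deriv_comp_add_const, h.eq_u]
  eq_v x := by rw [deriv_deriv_comp_add_const, h.eq_v]
  mem_u _ := h.mem_u _
  mem_v _ := h.mem_v _
  omega_lt_mul _ := h.omega_lt_mul _

theorem const (hw : IsWellPair α ω a b) : IsBoxSolution α ω a b (fun _ => b) (fun _ => a) where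
  contDiff_u := contDiff_const
  contDiff_v := contDiff_const
  eq_u _ := by
    simp only [rhsF, deriv_const']
    linear_combination (-b) * hw.sq_add_sq - a * hw.mul_eq
  eq_v _ := by
    simp only [rhsF, deriv_const']
    linear_combination (-a) * hw.sq_add_sq - b * hw.mul_eq
  mem_u _ := ⟨hw.lt.le, le_rfl⟩
  mem_v _ := ⟨le_rfl, hw.lt.le⟩
  omega_lt_mul _ := by linarith [hw.mul_eq, mul_pos hw.pos (hw.pos.trans hw.lt)]

theorem eq_of_initial (h : IsBoxSolution α ω a b u v) (h' : IsBoxSolution α ω a b u' v')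
    {x₀ : ℝ} (hu : u x₀ = u' x₀) (hv : v x₀ = v' x₀) (hu₁ : deriv u x₀ = deriv u' x₀)
    (hv₁ : deriv v x₀ = deriv v' x₀) : u = u' ∧ v = v' := by
  obtain ⟨K, hK⟩ := exists_lipschitzOnWith_rhsF_swap (α := α) (ω := ω)
    ((isCompact_Icc (a := a) (b := b)).prod (isCompact_Icc (a := a) (b := b)))
  have hderiv {u v : ℝ → ℝ} (h : IsBoxSolution α ω a b u v) (x : ℝ) :
      HasDerivAt (fun x => (u x, v x)) (deriv u x, deriv v x) x :=
    (hasDerivAt_of_contDiff_two h.contDiff_u x).prodMk (hasDerivAt_of_contDiff_two h.contDiff_v x)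
  have heq {u v : ℝ → ℝ} (h : IsBoxSolution α ω a b u v) (x : ℝ) :
      HasDerivAt (fun x => (deriv u x, deriv v x))
        (rhsF α ω (u x) (v x), rhsF α ω (v x) (u x)) x := by
    rw [← h.eq_u, ← h.eq_v]
    exact (hasDerivAt_deriv_of_contDiff_two h.contDiff_u x).prodMk
      (hasDerivAt_deriv_of_contDiff_two h.contDiff_v x)
  have huv := ODE_solution_unique_of_deriv_deriv_eq hK (hderiv h) (heq h)
    (fun x => ⟨h.mem_u x, h.mem_v x⟩) (hderiv h') (heq h') (fun x => ⟨h'.mem_u x, h'.mem_v x⟩)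
    (Prod.ext hu hv) (Prod.ext hu₁ hv₁)
  exact ⟨funext fun x => congrArg Prod.fst (congrFun huv x),
    funext fun x => congrArg Prod.snd (congrFun huv x)⟩

theorem eq_of_le_of_eq_left (h : IsBoxSolution α ω a b u v) (h' : IsBoxSolution α ω a b u' v')
    (hα : 0 ≤ α) (ha : 0 < a) (hle : ∀ x, u' x ≤ u x ∧ v x ≤ v' x) {x₀ : ℝ}
    (h₀ : u' x₀ = u x₀) : u' = u ∧ v' = v := by
  have hu₂ := deriv_deriv_le_of_le_of_eq h'.contDiff_u h.contDiff_u (fun x => (hle x).1) h₀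
  rw [h.eq_u, h'.eq_u, h₀] at hu₂
  have hv₀ : v x₀ = v' x₀ := by
    refine (hle x₀).2.eq_of_not_lt fun hlt => hu₂.not_gt ?_
    exact rhsF_lt_rhsF hα (ha.trans_le (h.mem_u x₀).1) (ha.trans_le (h.mem_v x₀).1).le hlt
      (h.omega_lt_mul x₀)
  have hu₁ := deriv_eq_of_le_of_eq (hasDerivAt_of_contDiff_two h'.contDiff_u x₀).differentiableAt
    (hasDerivAt_of_contDiff_two h.contDiff_u x₀).differentiableAt (fun x => (hle x).1) h₀
  have hv₁ := deriv_eq_of_le_of_eq (hasDerivAt_of_contDiff_two h.contDiff_v x₀).differentiableAt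
    (hasDerivAt_of_contDiff_two h'.contDiff_v x₀).differentiableAt (fun x => (hle x).2) hv₀
  exact h'.eq_of_initial h h₀ hv₀.symm hu₁ hv₁.symm

theorem eq_of_le_of_eq (h : IsBoxSolution α ω a b u v) (h' : IsBoxSolution α ω a b u' v')
    (hα : 0 ≤ α) (ha : 0 < a) (hle : ∀ x, u' x ≤ u x ∧ v x ≤ v' x) {x₀ : ℝ}
    (h₀ : u' x₀ = u x₀ ∨ v' x₀ = v x₀) : u' = u ∧ v' = v := by
  rcases h₀ with h₀ | h₀
  · exact h.eq_of_le_of_eq_left h' hα ha hle h₀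
  · obtain ⟨hv, hu⟩ :=
      h'.swap.eq_of_le_of_eq_left h.swap hα ha (fun x => (hle x).symm) h₀.symm
    exact ⟨hu.symm, hv.symm⟩

end IsBoxSolution

/-! ### Comparison near the wells -/

theorem tendsto_add_smul_nhdsGT_zero {E : Type*} [NormedAddCommGroup E] [NormedSpace ℝ E]
    (p₀ w : E) : Tendsto (fun z : E × ℝ => z.1 + z.2 • w) (𝓝 p₀ ×ˢ 𝓝[>] 0) (𝓝 p₀) := by
  have hcont : Continuous fun z : E × ℝ => z.1 + z.2 • w := by fun_prop
  have hlim := hcont.tendsto (p₀, 0)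
  rw [zero_smul, add_zero, nhds_prod_eq] at hlim
  exact hlim.mono_left (prod_mono_right _ nhdsWithin_le_nhds)

theorem eventually_add_smul_lt_of_hasLineDerivAt_neg {E : Type*} [NormedAddCommGroup E]
    [NormedSpace ℝ E] {f : E → ℝ} {c : ℝ} {p₀ w : E} (hf : ContDiffAt ℝ 1 f p₀)
    (hline : HasLineDerivAt ℝ f c p₀ w) (hc : c < 0) :
    ∀ᶠ z : E × ℝ in 𝓝 p₀ ×ˢ 𝓝[>] 0, f (z.1 + z.2 • w) < f z.1 := by
  have hstrict : HasStrictFDerivAt f (fderiv ℝ f p₀) p₀ := hf.hasStrictFDerivAt one_ne_zero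
  have hfw : fderiv ℝ f p₀ w = c := (hstrict.hasFDerivAt.hasLineDerivAt w).unique hline
  have hδ : 0 < -c / (‖w‖ + 1) := div_pos (neg_pos.2 hc) (by positivity)
  have hpos : ∀ᶠ z : E × ℝ in 𝓝 p₀ ×ˢ 𝓝[>] 0, 0 < z.2 := tendsto_snd.eventually
    (eventually_mem_nhdsWithin (a := (0 : ℝ)) (s := Set.Ioi 0))
  filter_upwards [(hstrict.isLittleO.comp_tendsto
      ((tendsto_add_smul_nhdsGT_zero p₀ w).prodMk_nhds tendsto_fst)).def hδ, hpos] with z hz hm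
  simp only [Function.comp_apply, add_sub_cancel_left, map_smul, hfw, smul_eq_mul, norm_smul,
    Real.norm_eq_abs, abs_of_pos hm] at hz
  have hsmall : -c / (‖w‖ + 1) * (z.2 * ‖w‖) < z.2 * -c := by
    rw [div_mul_eq_mul_div, div_lt_iff₀ (by positivity)]
    linarith [mul_pos hm (neg_pos.2 hc)]
  linarith [le_abs_self (f (z.1 + z.2 • w) - f z.1 - z.2 * c)]

theorem hasDerivAt_rhsF {α ω x u' v' : ℝ} {u v : ℝ → ℝ} (hu : HasDerivAt u u' x)
    (hv : HasDerivAt v v' x) :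
    HasDerivAt (fun y => rhsF α ω (u y) (v y))
      ((3 * u x ^ 2 + (1 + α) * v x ^ 2 - 1) * u' + (2 * (1 + α) * (u x * v x) - ω) * v') x := by
  have h := (hu.fun_neg.fun_mul (((hu.fun_pow 2).const_sub 1).fun_sub (hv.fun_pow 2))).fun_sub
    (hv.fun_mul (((hu.const_mul α).fun_mul hv).const_sub ω))
  refine h.congr_deriv ?_
  norm_num
  ring

theorem hasLineDerivAt_rhsF (α ω p q r s : ℝ) :
    HasLineDerivAt ℝ (fun z : ℝ × ℝ => rhsF α ω z.1 z.2)
      ((3 * p ^ 2 + (1 + α) * q ^ 2 - 1) * r + (2 * (1 + α) * (p * q) - ω) * s)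
      (p, q) (r, s) := by
  have hline (c d : ℝ) : HasDerivAt (fun t => c + t * d) d 0 := by
    simpa only [id, one_mul] using ((hasDerivAt_id (0 : ℝ)).mul_const d).const_add c
  refine (hasDerivAt_rhsF (α := α) (ω := ω) (hline p r) (hline q s)).congr_deriv ?_
  simp only [zero_mul, add_zero]

theorem hasLineDerivAt_rhsF_swap (α ω p q r s : ℝ) :
    HasLineDerivAt ℝ (fun z : ℝ × ℝ => rhsF α ω z.2 z.1)
      ((3 * q ^ 2 + (1 + α) * p ^ 2 - 1) * s + (2 * (1 + α) * (q * p) - ω) * r)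
      (p, q) (r, s) :=
  hasLineDerivAt_rhsF α ω q p s r

/-- Moving the state from `(p, q)` to `(p', q')` lowers the force on the first component, raises
the force on the second, and ends in the region where the system is competitive. -/
structure IsCompetitiveShift (α ω p q p' q' : ℝ) : Prop where
  fst_pos : 0 < p'
  snd_pos : 0 < q'
  omega_lt_mul : ω < (2 + α) * (p' * q')
  rhsF_fst_lt : rhsF α ω p' q' < rhsF α ω p q
  lt_rhsF_snd : rhsF α ω q p < rhsF α ω q' p'

namespace IsCompetitiveShift

variable {α ω p q p' q' : ℝ}

theorem rhsF_fst_lt_of_le (hs : IsCompetitiveShift α ω p q p' q') (hα : 0 ≤ α) {v : ℝ}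
    (hv : 0 ≤ v) (hle : v ≤ q') (hω : ω < (2 + α) * (p' * v)) :
    rhsF α ω p' v < rhsF α ω p q :=
  (rhsF_le_rhsF hα hs.fst_pos hv hle hω).trans_lt hs.rhsF_fst_lt

theorem lt_rhsF_snd_of_le (hs : IsCompetitiveShift α ω p q p' q') (hα : 0 ≤ α) {u : ℝ}
    (hle : p' ≤ u) : rhsF α ω q p < rhsF α ω q' u :=
  hs.lt_rhsF_snd.trans_le (rhsF_le_rhsF hα hs.snd_pos hs.fst_pos.le hle
    (by rw [mul_comm q']; exact hs.omega_lt_mul))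

end IsCompetitiveShift

theorem IsWellPair.eventually_competitive {α ω a b : ℝ} (hw : IsWellPair α ω a b) :
    ∀ᶠ z : ℝ × ℝ in 𝓝 (a, b), 0 < z.1 ∧ 0 < z.2 ∧ ω < (2 + α) * (z.1 * z.2) := by
  have hb : 0 < b := hw.pos.trans hw.lt
  have hω : ω < (2 + α) * (a * b) := by linarith [hw.mul_eq, mul_pos hw.pos hb]
  exact (continuousAt_const.eventually_lt continuousAt_fst hw.pos).and
    ((continuousAt_const.eventually_lt continuousAt_snd hb).and
      (continuousAt_const.eventually_lt (by fun_prop) hω))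

/-- The direction `(-φ, ψ)` comes from the Jacobian of the forces at `(a, b)`, whose diagonal
entries are `f = 2a² + αb²` and `g = 2b² + αa²`, and whose off-diagonal entry is `k = (α + 2)ab`:
the choice `φ = g + k`, `ψ = f + k` works because `f g - k² = 2α(b² - a²)² > 0`. -/
theorem IsWellPair.exists_isCompetitiveShift {α ω a b : ℝ} (hw : IsWellPair α ω a b) :
    ∃ φ > 0, ∃ ψ > 0, ∃ ε > 0, ∀ᶠ z in 𝓝 (a, b), ∀ m ∈ Set.Ioo 0 ε,
      IsCompetitiveShift α ω z.1 z.2 (z.1 - m * φ) (z.2 + m * ψ) := by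
  have hα := hw.alpha_pos
  have ha := hw.pos
  have hb : 0 < b := ha.trans hw.lt
  set φ : ℝ := 2 * b ^ 2 + α * a ^ 2 + (α + 2) * (a * b)
  set ψ : ℝ := 2 * a ^ 2 + α * b ^ 2 + (α + 2) * (a * b)
  have hdet : -(2 * α * (b ^ 2 - a ^ 2) ^ 2) < 0 := by
    have : 0 < b ^ 2 - a ^ 2 := by nlinarith [hw.lt]
    exact neg_neg_of_pos (by positivity)
  have hlineF : HasLineDerivAt ℝ (fun z : ℝ × ℝ => rhsF α ω z.1 z.2)
      (-(2 * α * (b ^ 2 - a ^ 2) ^ 2)) (a, b) (-φ, ψ) := by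
    refine (hasLineDerivAt_rhsF α ω a b (-φ) ψ).congr_deriv ?_
    linear_combination (-φ) * hw.sq_add_sq + ψ * hw.mul_eq
  have hlineG : HasLineDerivAt ℝ (fun z : ℝ × ℝ => -rhsF α ω z.2 z.1)
      (-(2 * α * (b ^ 2 - a ^ 2) ^ 2)) (a, b) (-φ, ψ) := by
    refine (hasLineDerivAt_rhsF_swap α ω a b (-φ) ψ).fun_neg.congr_deriv ?_
    linear_combination (-ψ) * hw.sq_add_sq + φ * hw.mul_eq
  have hregion := (tendsto_add_smul_nhdsGT_zero (a, b) (-φ, ψ)).eventually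
    hw.eventually_competitive
  have hF := eventually_add_smul_lt_of_hasLineDerivAt_neg
    (by unfold rhsF; fun_prop) hlineF hdet
  have hG := eventually_add_smul_lt_of_hasLineDerivAt_neg
    (by unfold rhsF; fun_prop) hlineG hdet
  obtain ⟨P, hP, R, hR, hPR⟩ := eventually_prod_iff.1 (hregion.and (hF.and hG))
  obtain ⟨ε, hε, hεR⟩ := mem_nhdsGT_iff_exists_Ioo_subset.1 hR
  refine ⟨φ, by positivity, ψ, by positivity, ε, hε, hP.mono fun z hz m hm => ?_⟩
  obtain ⟨⟨hfst, hsnd, hω⟩, hFz, hGz⟩ := hPR hz (hεR hm)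
  simp only [Prod.fst_add, Prod.snd_add, Prod.smul_mk, smul_eq_mul, mul_neg, ← sub_eq_add_neg]
    at hfst hsnd hω hFz hGz
  exact ⟨hfst, hsnd, hω, hFz, neg_lt_neg_iff.1 hGz⟩

theorem deriv_deriv_le_of_isLocalMin_sub_div {f g : ℝ → ℝ} {c y : ℝ} (hf : ContDiff ℝ 2 f)
    (hg : ContDiff ℝ 2 g) (hc : 0 < c) (h : IsLocalMin (fun x => (f x - g x) / c) y) :
    deriv (deriv g) y ≤ deriv (deriv f) y := by
  have hsub : IsLocalMin (fun x => f x - g x) y :=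
    h.mono fun _ hx => (div_le_div_iff_of_pos_right hc).1 hx
  have hconvex :=
    deriv_deriv_nonneg_of_isLocalMin hsub (hf.continuous.sub hg.continuous).continuousAt
  rwa [deriv_deriv_sub hf hg, sub_nonneg] at hconvex

theorem isLocalMin_left_of_isLocalMin_min {X R : Type*} [TopologicalSpace X] [LinearOrder R]
    {f g : X → R} {y : X} (h : IsLocalMin (fun x => min (f x) (g x)) y) (hle : f y ≤ g y) :
    IsLocalMin f y :=
  h.mono fun _ hx => (min_eq_left hle).symm.le.trans (hx.trans (min_le_left _ _))

theorem IsBoxSolution.not_isLocalMin_min {α ω a b : ℝ} {u v u' v' : ℝ → ℝ}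
    (h : IsBoxSolution α ω a b u v) (h' : IsBoxSolution α ω a b u' v') (hα : 0 ≤ α) (ha : 0 < a)
    {φ ψ m y : ℝ} (hφ : 0 < φ) (hψ : 0 < ψ)
    (hm : min ((u y - u' y) / φ) ((v' y - v y) / ψ) = -m)
    (hs : IsCompetitiveShift α ω (u' y) (v' y) (u' y - m * φ) (v' y + m * ψ)) :
    ¬IsLocalMin (fun x => min ((u x - u' x) / φ) ((v' x - v x) / ψ)) y := by
  intro hmin
  rcases le_total ((u y - u' y) / φ) ((v' y - v y) / ψ) with hle | hle
  · rw [min_eq_left hle] at hm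
    have hu : u' y - m * φ = u y := by linarith [(div_eq_iff hφ.ne').1 hm]
    have hv : v y ≤ v' y + m * ψ := by linarith [(le_div_iff₀ hψ).1 (hm ▸ hle)]
    have hconvex := deriv_deriv_le_of_isLocalMin_sub_div h.contDiff_u h'.contDiff_u hφ
      (isLocalMin_left_of_isLocalMin_min hmin hle)
    rw [h.eq_u, h'.eq_u, ← hu] at hconvex
    exact hconvex.not_gt (hs.rhsF_fst_lt_of_le hα (ha.le.trans (h.mem_v y).1) hv
      (hu.symm ▸ h.omega_lt_mul y))
  · rw [min_eq_right hle] at hm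
    have hv : v' y + m * ψ = v y := by linarith [(div_eq_iff hψ.ne').1 hm]
    have hu : u' y - m * φ ≤ u y := by linarith [(le_div_iff₀ hφ).1 (hm ▸ hle)]
    have hconvex := deriv_deriv_le_of_isLocalMin_sub_div h'.contDiff_v h.contDiff_v hψ
      (isLocalMin_left_of_isLocalMin_min
        (by simpa only [min_comm ((v' _ - v _) / ψ)] using hmin) hle)
    rw [h.eq_v, h'.eq_v, ← hv] at hconvex
    exact hconvex.not_gt (hs.lt_rhsF_snd_of_le hα hu)

theorem IsWellPair.exists_comparison_left {α ω a b : ℝ} (hw : IsWellPair α ω a b) :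
    ∃ U ∈ 𝓝 (a, b), ∀ {u v u' v' : ℝ → ℝ} {x₁ : ℝ}, IsBoxSolution α ω a b u v →
      IsBoxSolution α ω a b u' v' → Tendsto (fun x => u x - u' x) atBot (𝓝 0) →
      Tendsto (fun x => v' x - v x) atBot (𝓝 0) → (∀ x ≤ x₁, (u' x, v' x) ∈ U) →
      u' x₁ ≤ u x₁ → v x₁ ≤ v' x₁ → ∀ x ≤ x₁, u' x ≤ u x ∧ v x ≤ v' x := by
  obtain ⟨φ, hφ, ψ, hψ, ε, hε, hshift⟩ := hw.exists_isCompetitiveShift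
  have hclose : ∀ᶠ z : ℝ × ℝ in 𝓝 (a, b), -ε < (a - z.1) / φ ∧ -ε < (z.2 - b) / ψ := by
    refine .and ?_ ?_ <;> refine continuousAt_const.eventually_lt (by fun_prop) ?_ <;>
      simpa only [sub_self, zero_div, neg_lt_zero] using hε
  refine ⟨_, hshift.and hclose, fun {u v u' v' x₁} h h' hu hv hU hu₁ hv₁ => ?_⟩
  let g (x : ℝ) : ℝ := min ((u x - u' x) / φ) ((v' x - v x) / ψ)
  have hg : Continuous g :=
    ((h.contDiff_u.continuous.sub h'.contDiff_u.continuous).div_const φ).min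
      ((h'.contDiff_v.continuous.sub h.contDiff_v.continuous).div_const ψ)
  have hgbot : Tendsto g atBot (𝓝 0) := by
    simpa only [zero_div, min_self] using (hu.div_const φ).min (hv.div_const ψ)
  suffices hnonneg : ∀ x ≤ x₁, 0 ≤ g x by
    intro x hx
    obtain ⟨hgu, hgv⟩ := le_min_iff.1 (hnonneg x hx)
    rw [le_div_iff₀ hφ, zero_mul, sub_nonneg] at hgu
    rw [le_div_iff₀ hψ, zero_mul, sub_nonneg] at hgv
    exact ⟨hgu, hgv⟩
  by_contra! ⟨x, hx, hneg⟩
  obtain ⟨y, hy, hymin⟩ := exists_forall_le_Iic_of_tendsto hg hgbot hneg hx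
  have hgy : g y < 0 := (hymin x hx).trans_lt hneg
  have hg₁ : 0 ≤ g x₁ :=
    le_min (div_nonneg (sub_nonneg.2 hu₁) hφ.le) (div_nonneg (sub_nonneg.2 hv₁) hψ.le)
  have hyx₁ : y < x₁ := hy.lt_of_ne fun heq => hgy.not_ge (heq ▸ hg₁)
  obtain ⟨hshift_y, hu_close, hv_close⟩ := hU y hy
  have hgε : -ε < g y := lt_min
    (hu_close.trans_le ((div_le_div_iff_of_pos_right hφ).2 (sub_le_sub_right (h.mem_u y).1 _)))
    (hv_close.trans_le ((div_le_div_iff_of_pos_right hψ).2 (sub_le_sub_left (h.mem_v y).2 _)))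
  exact h.not_isLocalMin_min h' hw.alpha_pos.le hw.pos hφ hψ (neg_neg (g y)).symm
    (hshift_y (-g y) ⟨neg_pos.2 hgy, neg_lt.1 hgε⟩)
    ((eventually_le_nhds hyx₁).mono hymin)

theorem IsWellPair.exists_comparison_right {α ω a b : ℝ} (hw : IsWellPair α ω a b) :
    ∃ U ∈ 𝓝 (b, a), ∀ {u v u' v' : ℝ → ℝ} {x₁ : ℝ}, IsBoxSolution α ω a b u v →
      IsBoxSolution α ω a b u' v' → Tendsto (fun x => u x - u' x) atTop (𝓝 0) →
      Tendsto (fun x => v' x - v x) atTop (𝓝 0) → (∀ x ≥ x₁, (u x, v x) ∈ U) →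
      u' x₁ ≤ u x₁ → v x₁ ≤ v' x₁ → ∀ x ≥ x₁, u' x ≤ u x ∧ v x ≤ v' x := by
  obtain ⟨U, hU, hcomp⟩ := hw.exists_comparison_left
  refine ⟨Prod.swap ⁻¹' U, continuous_swap.continuousAt hU,
    fun {u v u' v' x₁} h h' hu hv hmem hu₁ hv₁ x hx => ?_⟩
  have hreflect (x : ℝ) : 0 - (0 - x) = x := by ring
  have hbot : Tendsto (fun x : ℝ => 0 - x) atBot atTop := by
    simpa only [zero_sub] using tendsto_neg_atBot_atTop
  have hle := hcomp (h'.swap.comp_const_sub 0) (h.swap.comp_const_sub 0) (hv.comp hbot)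
    (hu.comp hbot) (x₁ := 0 - x₁) (fun y hy => hmem (0 - y) (by linarith))
    (by simpa only [hreflect] using hv₁) (by simpa only [hreflect] using hu₁) (0 - x)
    (by linarith)
  simpa only [hreflect, and_comm] using hle

/-! ### Sliding -/

namespace IsPositiveHeteroclinic

variable {α ω a b : ℝ} {u v u' v' : ℝ → ℝ}

theorem lt_and_lt (h : IsPositiveHeteroclinic α ω a b u v) (hw : IsWellPair α ω a b) (x : ℝ) :
    u x < b ∧ a < v x := by
  have hbox := h.isBoxSolution hw
  have hne : ¬(u x = b ∨ a = v x) := fun htouch => by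
    have heq := (IsBoxSolution.const hw).eq_of_le_of_eq hbox hw.alpha_pos.le hw.pos
      (fun y => ⟨(hbox.mem_u y).2, (hbox.mem_v y).1⟩) (htouch.imp_right Eq.symm)
    exact hw.lt.ne (tendsto_nhds_unique h.tendsto_u_atBot (heq.1 ▸ tendsto_const_nhds))
  rw [not_or] at hne
  exact ⟨(hbox.mem_u x).2.lt_of_ne hne.1, (hbox.mem_v x).1.lt_of_ne hne.2⟩

theorem exists_compact_comparison (h : IsPositiveHeteroclinic α ω a b u v)
    (h' : IsPositiveHeteroclinic α ω a b u' v') (hw : IsWellPair α ω a b) :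
    ∃ x₁ x₂, ∀ T, (∀ x ∈ Set.Icc x₁ (max x₁ (x₂ - T)), u' x ≤ u (x + T) ∧ v (x + T) ≤ v' x) →
      ∀ x, u' x ≤ u (x + T) ∧ v (x + T) ≤ v' x := by
  obtain ⟨U, hU, hleft⟩ := hw.exists_comparison_left
  obtain ⟨V, hV, hright⟩ := hw.exists_comparison_right
  obtain ⟨x₁, hx₁⟩ := eventually_atBot.1
    ((h'.tendsto_u_atBot.prodMk_nhds h'.tendsto_v_atBot).eventually hU)
  obtain ⟨x₂, hx₂⟩ := eventually_atTop.1
    ((h.tendsto_u_atTop.prodMk_nhds h.tendsto_v_atTop).eventually hV)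
  have hbox' := h'.isBoxSolution hw
  refine ⟨x₁, x₂, fun T hcompact x => ?_⟩
  have hbox := (h.isBoxSolution hw).comp_add_const T
  have hbot := tendsto_atBot_add_const_right atBot T tendsto_id
  have htop := tendsto_atTop_add_const_right atTop T tendsto_id
  rcases le_total x x₁ with hx | hx
  · obtain ⟨hu₁, hv₁⟩ := hcompact x₁ ⟨le_rfl, le_max_left _ _⟩
    refine hleft hbox hbox' ?_ ?_ hx₁ hu₁ hv₁ x hx
    · simpa only [sub_self, Function.comp_def, id]
        using (h.tendsto_u_atBot.comp hbot).sub h'.tendsto_u_atBot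
    · simpa only [sub_self, Function.comp_def, id]
        using h'.tendsto_v_atBot.sub (h.tendsto_v_atBot.comp hbot)
  rcases le_total x (max x₁ (x₂ - T)) with hx' | hx'
  · exact hcompact x ⟨hx, hx'⟩
  · obtain ⟨hu₂, hv₂⟩ := hcompact _ ⟨le_max_left _ _, le_rfl⟩
    refine hright hbox hbox' ?_ ?_ (fun y hy => hx₂ _ ?_) hu₂ hv₂ x hx'
    · simpa only [sub_self, Function.comp_def, id]
        using (h.tendsto_u_atTop.comp htop).sub h'.tendsto_u_atTop
    · simpa only [sub_self, Function.comp_def, id]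
        using h'.tendsto_v_atTop.sub (h.tendsto_v_atTop.comp htop)
    · exact sub_le_iff_le_add.1 ((le_max_right _ _).trans hy)

end IsPositiveHeteroclinic

/-- The shifts `T` such that `(u, v)`, translated by `T` or by any larger amount, lies above
`(u', v')` in the competitive order. -/
def slideSet (u v u' v' : ℝ → ℝ) : Set ℝ :=
  {T | ∀ T' ≥ T, ∀ x, u' x ≤ u (x + T') ∧ v (x + T') ≤ v' x}

theorem csInf_mem_slideSet {u v u' v' : ℝ → ℝ} (hu : Continuous u) (hv : Continuous v)
    (hne : (slideSet u v u' v').Nonempty) :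
    sInf (slideSet u v u' v') ∈ slideSet u v u' v' := by
  have hclosed : IsClosed {T | ∀ x, u' x ≤ u (x + T) ∧ v (x + T) ≤ v' x} := by
    simp only [Set.ofPred_forall, Set.ofPred_and]
    refine isClosed_iInter fun x => .inter ?_ ?_
    · exact isClosed_le continuous_const (hu.comp (continuous_const_add x))
    · exact isClosed_le (hv.comp (continuous_const_add x)) continuous_const
  have hIoi : Set.Ioi (sInf (slideSet u v u' v')) ⊆
      {T | ∀ x, u' x ≤ u (x + T) ∧ v (x + T) ≤ v' x} := fun T' hT' => by
    obtain ⟨T, hT, hlt⟩ := exists_lt_of_csInf_lt hne hT'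
    exact hT T' hlt.le
  have hIci := closure_minimal hIoi hclosed
  rw [closure_Ioi] at hIci
  exact fun T' hT' => hIci hT'

namespace IsPositiveHeteroclinic

variable {α ω a b : ℝ} {u v u' v' : ℝ → ℝ}

theorem slideSet_nonempty (h : IsPositiveHeteroclinic α ω a b u v)
    (h' : IsPositiveHeteroclinic α ω a b u' v') (hw : IsWellPair α ω a b) :
    (slideSet u v u' v').Nonempty := by
  obtain ⟨x₁, x₂, hcompact⟩ := h.exists_compact_comparison h' hw
  obtain ⟨hu, hv⟩ := h'.lt_and_lt hw x₁
  obtain ⟨y, hy⟩ := eventually_atTop.1 ((h.tendsto_u_atTop.eventually_const_le hu).and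
    (h.tendsto_v_atTop.eventually_le_const hv))
  refine ⟨max y x₂ - x₁, fun T hT => hcompact T fun x hx => ?_⟩
  obtain ⟨hy_le, hx₂_le⟩ := max_le_iff.1 (sub_le_iff_le_add'.1 hT)
  rw [max_eq_left (sub_le_iff_le_add.2 hx₂_le), Set.Icc_self, Set.mem_singleton_iff] at hx
  exact hx ▸ hy _ hy_le

theorem bddBelow_slideSet (h : IsPositiveHeteroclinic α ω a b u v)
    (h' : IsPositiveHeteroclinic α ω a b u' v') (hw : IsWellPair α ω a b) :
    BddBelow (slideSet u v u' v') := by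
  obtain ⟨x, hx⟩ := (h'.tendsto_u_atTop.eventually_const_lt hw.lt).exists
  obtain ⟨T, hT⟩ := ((h.tendsto_u_atBot.comp
    (tendsto_atBot_add_const_left atBot x tendsto_id)).eventually_lt_const hx).exists
  exact ⟨T, fun T' hT' => le_of_not_ge fun hle => hT.not_ge (hT' T hle x).1⟩

theorem exists_lt_mem_slideSet (h : IsPositiveHeteroclinic α ω a b u v)
    (h' : IsPositiveHeteroclinic α ω a b u' v') (hw : IsWellPair α ω a b) {T : ℝ}
    (hT : T ∈ slideSet u v u' v') (hlt : ∀ x, u' x < u (x + T) ∧ v (x + T) < v' x) :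
    ∃ T₀ < T, T₀ ∈ slideSet u v u' v' := by
  obtain ⟨x₁, x₂, hcompact⟩ := h.exists_compact_comparison h' hw
  have hu := h.contDiff_u.continuous
  have hv := h.contDiff_v.continuous
  have hu' := h'.contDiff_u.continuous
  have hv' := h'.contDiff_v.continuous
  have hnear : ∀ᶠ t in 𝓝 T, ∀ x ∈ Set.Icc x₁ (max x₁ (x₂ - (T - 1))),
      u' x < u (x + t) ∧ v (x + t) < v' x := by
    refine isCompact_Icc.eventually_forall_of_forall_eventually fun x _ => ?_
    exact (ContinuousAt.eventually_lt (by fun_prop) (by fun_prop) (hlt x).1).and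
      (ContinuousAt.eventually_lt (by fun_prop) (by fun_prop) (hlt x).2)
  obtain ⟨l, hl, hIoc⟩ := exists_Ioc_subset_of_mem_nhds
    (hnear.and (eventually_ge_nhds (sub_one_lt T))) ⟨T - 1, sub_one_lt T⟩
  refine ⟨(l + T) / 2, add_div_two_lt_right.2 hl, fun t ht => ?_⟩
  rcases le_total T t with hle | hle
  · exact hT t hle
  obtain ⟨ht_lt, ht_ge⟩ := hIoc ⟨(left_lt_add_div_two.2 hl).trans_le ht, hle⟩
  refine hcompact t fun x hx => ?_
  have hx_lt := ht_lt x ⟨hx.1, hx.2.trans (max_le_max_left _ (sub_le_sub_left ht_ge _))⟩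
  exact ⟨hx_lt.1.le, hx_lt.2.le⟩

theorem exists_eq_translate (h : IsPositiveHeteroclinic α ω a b u v)
    (h' : IsPositiveHeteroclinic α ω a b u' v') (hw : IsWellPair α ω a b) :
    ∃ T ∈ slideSet u v u' v', (∀ x, u' x = u (x + T)) ∧ ∀ x, v' x = v (x + T) := by
  have hmem := csInf_mem_slideSet h.contDiff_u.continuous h.contDiff_v.continuous
    (h.slideSet_nonempty h' hw)
  set T := sInf (slideSet u v u' v')
  refine ⟨T, hmem, ?_⟩
  have hle := hmem T le_rfl
  obtain ⟨x₀, htouch⟩ : ∃ x, u' x = u (x + T) ∨ v' x = v (x + T) := by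
    by_contra! hne
    obtain ⟨T₀, hlt, hT₀⟩ := h.exists_lt_mem_slideSet h' hw hmem fun x =>
      ⟨(hle x).1.lt_of_ne (hne x).1, (hle x).2.lt_of_ne (hne x).2.symm⟩
    exact hlt.not_ge (csInf_le (h.bddBelow_slideSet h' hw) hT₀)
  obtain ⟨hu, hv⟩ := ((h.isBoxSolution hw).comp_add_const T).eq_of_le_of_eq
    (h'.isBoxSolution hw) hw.alpha_pos.le hw.pos hle htouch
  exact ⟨congrFun hu, congrFun hv⟩

theorem monotone_and_antitone (h : IsPositiveHeteroclinic α ω a b u v)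
    (hw : IsWellPair α ω a b) : Monotone u ∧ Antitone v := by
  obtain ⟨T, hT, hu, hv⟩ := h.exists_eq_translate h hw
  have hle {x y : ℝ} (hxy : x ≤ y) : u x ≤ u y ∧ v y ≤ v x := by
    have hslide := hT (y - x + T) (by linarith) x
    rwa [show x + (y - x + T) = y + T by ring, ← hu, ← hv] at hslide
  exact ⟨fun x y hxy => (hle hxy).1, fun x y hxy => (hle hxy).2⟩

theorem deriv_v_ne_zero_of_deriv_u_eq_zero (h : IsPositiveHeteroclinic α ω a b u v)
    (hw : IsWellPair α ω a b) {x : ℝ} (hu : deriv u x = 0) : deriv v x ≠ 0 := by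
  intro hv
  have hbox := h.isBoxSolution hw
  have hxx : 2 * x - x = x := by ring
  have heq := ((hbox.comp_const_sub (2 * x)).eq_of_initial hbox (x₀ := x) (by rw [hxx])
    (by rw [hxx]) (by rw [deriv_comp_const_sub, hxx, hu, neg_zero])
    (by rw [deriv_comp_const_sub, hxx, hv, neg_zero])).1
  have hlim : Tendsto (fun t => u (2 * x - t)) atBot (𝓝 b) :=
    h.tendsto_u_atTop.comp (tendsto_atTop_add_const_left atBot (2 * x) tendsto_neg_atBot_atTop)
  exact hw.lt.ne (tendsto_nhds_unique h.tendsto_u_atBot (heq ▸ hlim))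

theorem deriv_u_pos (h : IsPositiveHeteroclinic α ω a b u v) (hw : IsWellPair α ω a b) (x : ℝ) :
    0 < deriv u x := by
  obtain ⟨hmono, hanti⟩ := h.monotone_and_antitone hw
  refine (hmono.deriv_nonneg (x := x)).lt_of_ne' fun hzero => ?_
  refine h.deriv_v_ne_zero_of_deriv_u_eq_zero hw hzero (hanti.deriv_nonpos.antisymm ?_)
  have hmin : IsLocalMin (deriv u) x :=
    Eventually.of_forall fun y => hzero ▸ hmono.deriv_nonneg
  have hthird : deriv (deriv (deriv u)) x = (2 * (1 + α) * (u x * v x) - ω) * deriv v x := by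
    rw [funext h.eq_u, (hasDerivAt_rhsF (hasDerivAt_of_contDiff_two h.contDiff_u x)
      (hasDerivAt_of_contDiff_two h.contDiff_v x)).deriv, hzero, mul_zero, zero_add]
  have hcoeff : 0 < 2 * (1 + α) * (u x * v x) - ω := by
    linarith [h.omega_lt_mul hw x, mul_pos hw.alpha_pos (mul_pos (h.pos_u x) (h.pos_v x))]
  have hconvex := deriv_deriv_nonneg_of_isLocalMin hmin
    (hasDerivAt_deriv_of_contDiff_two h.contDiff_u x).continuousAt
  exact nonneg_of_mul_nonneg_right (hthird ▸ hconvex) hcoeff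

theorem deriv_v_neg (h : IsPositiveHeteroclinic α ω a b u v) (hw : IsWellPair α ω a b) (x : ℝ) :
    deriv v x < 0 := by
  have hreflect := h.reflect.deriv_u_pos hw (-x)
  rwa [deriv_comp_neg, neg_neg, neg_pos] at hreflect

end IsPositiveHeteroclinic

/-! ### The resolvent of the second derivative on the line -/

section Resolvent

open MeasureTheory
open scoped ENNReal

variable {κ : ℝ} {H : ℝ → ℝ}

theorem contDiff_two_of_hasDerivAt {f f' f'' : ℝ → ℝ} (hf : ∀ x, HasDerivAt f (f' x) x)
    (hf' : ∀ x, HasDerivAt f' (f'' x) x) (hcont : Continuous f'') : ContDiff ℝ 2 f := by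
  have hderiv : deriv f = f' := funext fun x => (hf x).deriv
  have hf'₁ : ContDiff ℝ 1 f' := contDiff_one_iff_deriv.2
    ⟨fun x => (hf' x).differentiableAt, by rwa [funext fun x => (hf' x).deriv]⟩
  rw [← one_add_one_eq_two, contDiff_succ_iff_deriv]
  exact ⟨fun x => (hf x).differentiableAt, fun htop => absurd htop (by decide), hderiv ▸ hf'₁⟩

theorem nonpos_of_mul_le_deriv_deriv {y : ℝ → ℝ} {k M : ℝ} (hk : 0 < k) (hy : ContDiff ℝ 2 y)
    (hM : ∀ x, y x ≤ M) (h : ∀ x, k * y x ≤ deriv (deriv y) x) (x : ℝ) : y x ≤ 0 := by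
  have hbarrier {δ : ℝ} (hδ : 0 < δ) : y x ≤ δ * (k * x ^ 2 + 2) := by
    have hq : ContDiff ℝ 2 fun t : ℝ => δ * (k * t ^ 2 + 2) := by fun_prop
    have hq₁ : (deriv fun t : ℝ => δ * (k * t ^ 2 + 2)) = fun t => 2 * δ * k * t := by
      ext t
      simp
      ring
    have hcont : Continuous fun t => y t - δ * (k * t ^ 2 + 2) := hy.continuous.sub hq.continuous
    have hsq : Tendsto (fun t : ℝ => t ^ 2) (cocompact ℝ) atTop := by
      simpa only [Real.norm_eq_abs, sq_abs, Function.comp_def] using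
        (tendsto_pow_atTop two_ne_zero).comp (tendsto_norm_cocompact_atTop (E := ℝ))
    have hlim : Tendsto (fun t => y t - δ * (k * t ^ 2 + 2)) (cocompact ℝ) atBot :=
      tendsto_atBot_mono (fun t => sub_le_sub_right (hM t) _) <|
        tendsto_atBot_add_const_left _ M <| tendsto_neg_atTop_atBot.comp <|
          ((tendsto_atTop_add_const_right _ 2 (hsq.const_mul_atTop hk)).const_mul_atTop hδ)
    obtain ⟨t, ht⟩ := hcont.exists_forall_ge hlim
    have hconcave := deriv_deriv_nonpos_of_isLocalMax (Eventually.of_forall ht) hcont.continuousAt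
    rw [deriv_deriv_sub hy hq, hq₁, deriv_const_mul_field', deriv_id''] at hconcave
    have hyt : y t ≤ 2 * δ := le_of_mul_le_mul_left (by linarith [h t]) hk
    linarith [ht x, mul_nonneg hδ.le (mul_nonneg hk.le (sq_nonneg t))]
  refine le_of_forall_pos_le_add fun ε hε => ?_
  have hpos : 0 < k * x ^ 2 + 2 := by positivity
  rw [zero_add]
  exact (hbarrier (div_pos hε hpos)).trans_eq (div_mul_cancel₀ ε hpos.ne')

/-- The Green function of `1 - κ⁻² d²/dx²` on the line. -/
noncomputable def greenKernel (κ x : ℝ) : ℝ := κ / 2 * Real.exp (-κ * |x|)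

/-- The resolvent `(1 - κ⁻² d²/dx²)⁻¹`: the bounded solution `z` of `z'' = κ² (z - H)`. -/
noncomputable def greenOp (κ : ℝ) (H : ℝ → ℝ) (x : ℝ) : ℝ := ∫ y, greenKernel κ (x - y) * H y

theorem greenKernel_nonneg (hκ : 0 < κ) (x : ℝ) : 0 ≤ greenKernel κ x := by
  unfold greenKernel
  positivity

theorem greenKernel_neg (κ x : ℝ) : greenKernel κ (-x) = greenKernel κ x := by
  simp only [greenKernel, abs_neg]

theorem greenKernel_le_greenKernel (hκ : 0 < κ) {x y : ℝ} (h : |x| ≤ |y|) :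
    greenKernel κ y ≤ greenKernel κ x := by
  unfold greenKernel
  have hmul := mul_le_mul_of_nonneg_left h hκ.le
  gcongr ?_ * Real.exp ?_
  linarith

theorem integral_greenKernel (hκ : 0 < κ) : ∫ x, greenKernel κ x = 1 := by
  unfold greenKernel
  rw [integral_comp_abs (f := fun x => κ / 2 * Real.exp (-κ * x)), integral_const_mul,
    integral_exp_mul_Ioi (neg_neg_of_pos hκ), mul_zero, Real.exp_zero]
  field_simp

theorem integrable_greenKernel (hκ : 0 < κ) : Integrable (greenKernel κ) :=
  integrable_of_integral_eq_one (integral_greenKernel hκ)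

theorem integral_greenKernel_sub (hκ : 0 < κ) (x : ℝ) : ∫ y, greenKernel κ (x - y) = 1 := by
  rw [integral_sub_left_eq_self (greenKernel κ), integral_greenKernel hκ]

theorem integrable_greenKernel_mul (hκ : 0 < κ) (hH : MemLp H ∞) (x : ℝ) :
    Integrable fun y => greenKernel κ (x - y) * H y :=
  ((integrable_greenKernel hκ).comp_sub_left x).mul_of_top_left hH

theorem greenOp_eq_integral_comp_sub (κ : ℝ) (H : ℝ → ℝ) (x : ℝ) :
    greenOp κ H x = ∫ y, greenKernel κ y * H (x - y) := by
  rw [greenOp, ← integral_sub_left_eq_self _ volume x]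
  simp only [sub_sub_cancel]

theorem greenOp_mono (hκ : 0 < κ) {H' : ℝ → ℝ} (hH : MemLp H ∞) (hH' : MemLp H' ∞)
    (hle : ∀ y, H y ≤ H' y) (x : ℝ) : greenOp κ H x ≤ greenOp κ H' x :=
  integral_mono (integrable_greenKernel_mul hκ hH x) (integrable_greenKernel_mul hκ hH' x)
    fun y => mul_le_mul_of_nonneg_left (hle y) (greenKernel_nonneg hκ _)

theorem greenOp_const (hκ : 0 < κ) (c x : ℝ) : greenOp κ (fun _ => c) x = c := by
  rw [greenOp, integral_mul_const, integral_greenKernel_sub hκ, one_mul]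

theorem greenOp_const_add_const_mul (hκ : 0 < κ) (hH : MemLp H ∞) (β₀ β₁ x : ℝ) :
    greenOp κ (fun y => β₀ + β₁ * H y) x = β₀ + β₁ * greenOp κ H x := by
  rw [← greenOp_const hκ β₀ x, greenOp_const hκ β₀ x]
  simp only [greenOp, mul_add, mul_left_comm _ β₁]
  rw [integral_add (integrable_greenKernel_mul hκ (memLp_top_const β₀) x)
    ((integrable_greenKernel_mul hκ hH x).const_mul β₁), integral_const_mul, integral_mul_const,
    integral_greenKernel_sub hκ, one_mul]

theorem greenOp_comp_neg (κ : ℝ) (H : ℝ → ℝ) (x : ℝ) :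
    greenOp κ (fun y => H (-y)) x = greenOp κ H (-x) := by
  rw [greenOp_eq_integral_comp_sub, greenOp_eq_integral_comp_sub, ← integral_neg_eq_self]
  simp only [greenKernel_neg, sub_neg_eq_add, neg_add, ← sub_eq_add_neg]

theorem greenOp_le (hκ : 0 < κ) {c : ℝ} (hH : MemLp H ∞) (hle : ∀ y, H y ≤ c) (x : ℝ) :
    greenOp κ H x ≤ c :=
  (greenOp_mono hκ hH (memLp_top_const c) hle x).trans_eq (greenOp_const hκ c x)

theorem le_greenOp (hκ : 0 < κ) {c : ℝ} (hH : MemLp H ∞) (hle : ∀ y, c ≤ H y) (x : ℝ) :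
    c ≤ greenOp κ H x :=
  (greenOp_const hκ c x).symm.trans_le (greenOp_mono hκ (memLp_top_const c) hH hle x)

theorem monotone_greenOp (hκ : 0 < κ) (hH : MemLp H ∞) (hmono : Monotone H) :
    Monotone (greenOp κ H) := by
  intro x x' hx
  have hint (x : ℝ) : Integrable fun y => greenKernel κ y * H (x - y) :=
    (integrable_greenKernel hκ).mul_of_top_left
      (hH.comp_measurePreserving (volume.measurePreserving_sub_left x))
  rw [greenOp_eq_integral_comp_sub, greenOp_eq_integral_comp_sub]
  exact integral_mono (hint x) (hint x') fun y =>
    mul_le_mul_of_nonneg_left (hmono (sub_le_sub_right hx y)) (greenKernel_nonneg hκ y)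

theorem integral_nonneg_of_add_comp_const_sub_nonneg {f : ℝ → ℝ} (hf : Integrable f) (c : ℝ)
    (h : ∀ y, 0 ≤ f y + f (c - y)) : 0 ≤ ∫ y, f y := by
  have hsum : ∫ y, (f y + f (c - y)) = 2 * ∫ y, f y := by
    rw [integral_add hf (hf.comp_sub_left c), integral_sub_left_eq_self f volume c, two_mul]
  have hnonneg : 0 ≤ ∫ y, (f y + f (c - y)) := integral_nonneg h
  linarith

theorem greenOp_nonneg_of_odd (hκ : 0 < κ) (hH : MemLp H ∞) (hodd : ∀ y, H (-y) = -H y)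
    (hnonneg : ∀ y, 0 ≤ y → 0 ≤ H y) {x : ℝ} (hx : 0 ≤ x) : 0 ≤ greenOp κ H x := by
  refine integral_nonneg_of_add_comp_const_sub_nonneg (integrable_greenKernel_mul hκ hH x) 0
    fun y => ?_
  have hpair : greenKernel κ (x - y) * H y + greenKernel κ (x - (0 - y)) * H (0 - y) =
      (greenKernel κ (x - y) - greenKernel κ (x + y)) * H y := by
    rw [zero_sub, hodd, sub_neg_eq_add]
    ring
  rw [hpair]
  rcases le_total 0 y with hy | hy
  · refine mul_nonneg (sub_nonneg.2 (greenKernel_le_greenKernel hκ ?_)) (hnonneg y hy)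
    exact sq_le_sq.1 (by nlinarith)
  · refine mul_nonneg_of_nonpos_of_nonpos (sub_nonpos.2 (greenKernel_le_greenKernel hκ ?_)) ?_
    · exact sq_le_sq.1 (by nlinarith)
    · linarith [hodd y, hnonneg (-y) (neg_nonneg.2 hy)]

theorem greenOp_mono_of_odd (hκ : 0 < κ) {H' : ℝ → ℝ} (hH : MemLp H ∞) (hH' : MemLp H' ∞)
    (hodd : ∀ y, H (-y) = -H y) (hodd' : ∀ y, H' (-y) = -H' y) (hle : ∀ y, 0 ≤ y → H y ≤ H' y)
    {x : ℝ} (hx : 0 ≤ x) : greenOp κ H x ≤ greenOp κ H' x := by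
  have hsub : greenOp κ (fun y => H' y - H y) x = greenOp κ H' x - greenOp κ H x := by
    simp only [greenOp, mul_sub]
    exact integral_sub (integrable_greenKernel_mul hκ hH' x) (integrable_greenKernel_mul hκ hH x)
  rw [← sub_nonneg, ← hsub]
  refine greenOp_nonneg_of_odd hκ (hH'.sub hH) (fun y => ?_) (fun y hy => sub_nonneg.2 (hle y hy))
    hx
  simp only [Pi.sub_apply, hodd, hodd']
  ring

theorem greenOp_le_greenOp_of_abs_le_abs (hκ : 0 < κ) (hH : MemLp H ∞)
    (heven : ∀ y z, |y| ≤ |z| → H y ≤ H z) {x x' : ℝ} (hx : |x| ≤ |x'|) :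
    greenOp κ H x ≤ greenOp κ H x' := by
  have hneg : (fun y => H (-y)) = H := funext fun y =>
    (heven _ _ (abs_neg y).le).antisymm (heven _ _ (abs_neg y).ge)
  have habs (x : ℝ) : greenOp κ H |x| = greenOp κ H x := by
    rcases abs_choice x with h | h <;> rw [h]
    rw [← greenOp_comp_neg, hneg]
  rw [← habs x, ← habs x']
  generalize |x| = s, |x'| = t, abs_nonneg x = hs at hx
  have hint := (integrable_greenKernel_mul hκ hH t).sub (integrable_greenKernel_mul hκ hH s)
  rw [← sub_nonneg, greenOp, greenOp, ← integral_sub (integrable_greenKernel_mul hκ hH t)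
    (integrable_greenKernel_mul hκ hH s)]
  refine integral_nonneg_of_add_comp_const_sub_nonneg hint (s + t) fun y => ?_
  have hpair : greenKernel κ (t - y) * H y - greenKernel κ (s - y) * H y +
      (greenKernel κ (t - (s + t - y)) * H (s + t - y) -
        greenKernel κ (s - (s + t - y)) * H (s + t - y)) =
      (greenKernel κ (t - y) - greenKernel κ (s - y)) * (H y - H (s + t - y)) := by
    rw [show t - (s + t - y) = -(s - y) by ring, show s - (s + t - y) = -(t - y) by ring,
      greenKernel_neg, greenKernel_neg]
    ring
  rw [hpair]
  rcases le_total (s + t) (2 * y) with hy | hy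
  · refine mul_nonneg (sub_nonneg.2 (greenKernel_le_greenKernel hκ (sq_le_sq.1 ?_)))
      (sub_nonneg.2 (heven _ _ (sq_le_sq.1 ?_))) <;> nlinarith
  · refine mul_nonneg_of_nonpos_of_nonpos
      (sub_nonpos.2 (greenKernel_le_greenKernel hκ (sq_le_sq.1 ?_)))
      (sub_nonpos.2 (heven _ _ (sq_le_sq.1 ?_))) <;> nlinarith

theorem tendsto_integral_greenKernel_mul (hκ : 0 < κ) {ι : Type*} {l : Filter ι}
    [l.IsCountablyGenerated] {F : ι → ℝ → ℝ} {F' : ℝ → ℝ} {M : ℝ}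
    (hF : ∀ i, AEStronglyMeasurable (F i)) (hM : ∀ i y, |F i y| ≤ M)
    (hl : ∀ y, Tendsto (fun i => F i y) l (𝓝 (F' y))) :
    Tendsto (fun i => ∫ y, greenKernel κ y * F i y) l (𝓝 (∫ y, greenKernel κ y * F' y)) := by
  refine tendsto_integral_filter_of_dominated_convergence (fun y => greenKernel κ y * M) ?_ ?_
    ((integrable_greenKernel hκ).mul_const M) ?_
  · exact Eventually.of_forall fun i => (integrable_greenKernel hκ).aestronglyMeasurable.mul (hF i)
  · refine Eventually.of_forall fun i => Eventually.of_forall fun y => ?_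
    rw [norm_mul, Real.norm_of_nonneg (greenKernel_nonneg hκ y)]
    exact mul_le_mul_of_nonneg_left (hM i y) (greenKernel_nonneg hκ y)
  · exact Eventually.of_forall fun y => (hl y).const_mul _

theorem tendsto_greenOp_atTop (hκ : 0 < κ) {M l : ℝ} (hH : Measurable H) (hM : ∀ y, |H y| ≤ M)
    (hl : Tendsto H atTop (𝓝 l)) : Tendsto (greenOp κ H) atTop (𝓝 l) := by
  have hlim : Tendsto (fun x => ∫ y, greenKernel κ y * H (x - y)) atTop
      (𝓝 (∫ y, greenKernel κ y * l)) :=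
    tendsto_integral_greenKernel_mul hκ
      (fun x => (hH.comp (measurable_const_sub x)).aestronglyMeasurable) (fun x y => hM _)
      fun y => hl.comp (tendsto_atTop_add_const_right atTop (-y) tendsto_id)
  simpa only [← greenOp_eq_integral_comp_sub, integral_mul_const, integral_greenKernel hκ,
    one_mul] using hlim

theorem tendsto_greenOp_of_tendsto (hκ : 0 < κ) {H : ℕ → ℝ → ℝ} {H' : ℝ → ℝ} {M : ℝ}
    (hH : ∀ n, Measurable (H n)) (hM : ∀ n y, |H n y| ≤ M)
    (hl : ∀ y, Tendsto (fun n => H n y) atTop (𝓝 (H' y))) (x : ℝ) :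
    Tendsto (fun n => greenOp κ (H n) x) atTop (𝓝 (greenOp κ H' x)) := by
  simp only [greenOp_eq_integral_comp_sub]
  exact tendsto_integral_greenKernel_mul hκ
    (fun n => ((hH n).comp (measurable_const_sub x)).aestronglyMeasurable) (fun n y => hM n _)
    fun y => hl (x - y)

/-- The contribution of `(-∞, x]` to the resolvent, up to the factor `κ / 2`; it solves the
first-order equation `z' = H - κ z`. -/
noncomputable def greenLeft (κ : ℝ) (H : ℝ → ℝ) (x : ℝ) : ℝ :=
  Real.exp (-κ * x) * ∫ y in Set.Iic x, Real.exp (κ * y) * H y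

theorem integrableOn_exp_mul_Iic_of_memLp (hκ : 0 < κ) (hH : MemLp H ∞) (x : ℝ) :
    IntegrableOn (fun y => Real.exp (κ * y) * H y) (Set.Iic x) :=
  Integrable.mul_of_top_left (integrableOn_exp_mul_Iic hκ x) (hH.restrict _)

theorem greenLeft_eq_add_intervalIntegral (hκ : 0 < κ) (hH : MemLp H ∞) (x : ℝ) :
    greenLeft κ H x = Real.exp (-κ * x) *
      ((∫ y in Set.Iic 0, Real.exp (κ * y) * H y) + ∫ y in 0..x, Real.exp (κ * y) * H y) := by
  rw [greenLeft, ← intervalIntegral.integral_Iic_sub_Iic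
    (integrableOn_exp_mul_Iic_of_memLp hκ hH 0) (integrableOn_exp_mul_Iic_of_memLp hκ hH x),
    add_sub_cancel]

theorem continuous_greenLeft (hκ : 0 < κ) (hH : MemLp H ∞) : Continuous (greenLeft κ H) := by
  have hprim := intervalIntegral.continuous_primitive (fun s t => intervalIntegrable_iff.2
    ((integrableOn_exp_mul_Iic_of_memLp hκ hH (max s t)).mono_set fun y hy => hy.2)) 0
  rw [funext (greenLeft_eq_add_intervalIntegral hκ hH)]
  fun_prop

theorem hasDerivAt_greenLeft (hκ : 0 < κ) (hH : MemLp H ∞) (hcont : Continuous H) (x : ℝ) :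
    HasDerivAt (greenLeft κ H) (H x - κ * greenLeft κ H x) x := by
  have hprim := ((by fun_prop : Continuous fun y => Real.exp (κ * y) * H y)
    |>.integral_hasStrictDerivAt 0 x).hasDerivAt.const_add
      (∫ y in Set.Iic 0, Real.exp (κ * y) * H y)
  have hexp := ((hasDerivAt_id x).const_mul (-κ)).exp
  have hcancel : Real.exp (-κ * x) * Real.exp (κ * x) = 1 := by
    rw [← Real.exp_add, neg_mul, neg_add_cancel, Real.exp_zero]
  rw [funext (greenLeft_eq_add_intervalIntegral hκ hH)]
  refine (hexp.mul hprim).congr_deriv ?_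
  simp only [id]
  linear_combination H x * hcancel

theorem greenOp_eq_greenLeft_add_greenLeft (hκ : 0 < κ) (hH : MemLp H ∞) (x : ℝ) :
    greenOp κ H x = κ / 2 * (greenLeft κ H x + greenLeft κ (fun y => H (-y)) (-x)) := by
  have hleft {H : ℝ → ℝ} {x : ℝ} : ∫ y in Set.Iic x, greenKernel κ (x - y) * H y =
      κ / 2 * greenLeft κ H x := by
    rw [greenLeft, ← integral_const_mul, ← integral_const_mul]
    refine setIntegral_congr_fun measurableSet_Iic fun y hy => ?_
    have hexp : Real.exp (-κ * |x - y|) = Real.exp (-κ * x) * Real.exp (κ * y) := by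
      rw [abs_of_nonneg (sub_nonneg.2 hy), ← Real.exp_add]
      ring_nf
    simp only [greenKernel, hexp]
    ring
  have hright : ∫ y in Set.Ioi x, greenKernel κ (x - y) * H y =
      κ / 2 * greenLeft κ (fun y => H (-y)) (-x) := by
    have hflip := integral_comp_neg_Iic (-x) fun y => greenKernel κ (x - y) * H y
    rw [neg_neg] at hflip
    rw [← hflip, ← hleft]
    refine integral_congr_ae (Eventually.of_forall fun y => ?_)
    simp only [← greenKernel_neg κ (x - -y), show -(x - -y) = -x - y by ring]
  have hint := integrable_greenKernel_mul hκ hH x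
  rw [greenOp, ← intervalIntegral.integral_Iic_add_Ioi hint.integrableOn hint.integrableOn, hleft,
    hright, mul_add]

theorem memLp_top_comp_neg (hH : MemLp H ∞) : MemLp (fun y => H (-y)) ∞ :=
  hH.comp_measurePreserving (Measure.measurePreserving_neg volume)

theorem continuous_greenOp (hκ : 0 < κ) (hH : MemLp H ∞) : Continuous (greenOp κ H) := by
  have hleft := continuous_greenLeft hκ hH
  have hright := continuous_greenLeft hκ (memLp_top_comp_neg hH)
  rw [funext (greenOp_eq_greenLeft_add_greenLeft hκ hH)]
  fun_prop

theorem greenOp_contDiff_two (hκ : 0 < κ) (hH : MemLp H ∞) (hcont : Continuous H) :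
    ContDiff ℝ 2 (greenOp κ H) ∧
      ∀ x, deriv (deriv (greenOp κ H)) x = κ ^ 2 * (greenOp κ H x - H x) := by
  have hleft := hasDerivAt_greenLeft hκ hH hcont
  have hright (x : ℝ) : HasDerivAt (fun x => greenLeft κ (fun y => H (-y)) (-x))
      (κ * greenLeft κ (fun y => H (-y)) (-x) - H x) x := by
    refine ((hasDerivAt_greenLeft hκ (memLp_top_comp_neg hH) (hcont.comp continuous_neg)
      (-x)).comp x (hasDerivAt_neg x)).congr_deriv ?_
    rw [neg_neg]
    ring
  have hderiv (x : ℝ) : HasDerivAt (greenOp κ H)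
      (κ ^ 2 / 2 * (greenLeft κ (fun y => H (-y)) (-x) - greenLeft κ H x)) x := by
    rw [funext (greenOp_eq_greenLeft_add_greenLeft hκ hH)]
    refine (((hleft x).add (hright x)).const_mul (κ / 2)).congr_deriv ?_
    ring
  have hderiv₂ (x : ℝ) : HasDerivAt
      (fun x => κ ^ 2 / 2 * (greenLeft κ (fun y => H (-y)) (-x) - greenLeft κ H x))
      (κ ^ 2 * (greenOp κ H x - H x)) x := by
    refine (((hright x).sub (hleft x)).const_mul (κ ^ 2 / 2)).congr_deriv ?_
    rw [greenOp_eq_greenLeft_add_greenLeft hκ hH]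
    ring
  refine ⟨contDiff_two_of_hasDerivAt hderiv hderiv₂
    (((continuous_greenOp hκ hH).sub hcont).const_mul _), fun x => ?_⟩
  rw [funext fun x => (hderiv x).deriv, (hderiv₂ x).deriv]

theorem le_greenOp_of_le_deriv_deriv (hκ : 0 < κ) {φ : ℝ → ℝ} {C M : ℝ} (hH : Continuous H)
    (hM : ∀ y, |H y| ≤ M) (hφ : ContDiff ℝ 2 φ) (hC : ∀ x, φ x ≤ C)
    (h : ∀ x, κ ^ 2 * (φ x - H x) ≤ deriv (deriv φ) x) (x : ℝ) : φ x ≤ greenOp κ H x := by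
  have hLp : MemLp H ∞ := memLp_top_of_bound hH.aestronglyMeasurable M (Eventually.of_forall hM)
  obtain ⟨hsmooth, heq⟩ := greenOp_contDiff_two hκ hLp hH
  refine sub_nonpos.1 (nonpos_of_mul_le_deriv_deriv (y := fun x => φ x - greenOp κ H x)
    (M := C + M) (pow_pos hκ 2) (hφ.sub hsmooth) (fun x => ?_) (fun x => ?_) x)
  · linarith [hC x, le_greenOp hκ hLp (fun y => (abs_le.1 (hM y)).1) x]
  · rw [deriv_deriv_sub hφ hsmooth, heq]
    linarith [h x]

end Resolvent

/-! ### Monotone iteration for cooperative systems -/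

section CooperativeSystem

open MeasureTheory
open scoped ENNReal

variable {κ : ℝ} {τ σ τ' σ' φ : ℝ → ℝ} {h₁ h₂ : ℝ × ℝ → ℝ}

/-- Odd, nondecreasing functions bounded by `1`. -/
structure IsOddProfile (τ : ℝ → ℝ) : Prop where
  map_neg : ∀ x, τ (-x) = -τ x
  monotone : Monotone τ
  le_one : ∀ x, τ x ≤ 1

/-- Even functions with values in `[0, 1]` which are nondecreasing on `[0, ∞)`, the last two
properties being encoded by monotonicity in `|x|`. -/
structure IsEvenProfile (σ : ℝ → ℝ) : Prop where
  le_of_abs_le_abs : ∀ x y, |x| ≤ |y| → σ x ≤ σ y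
  nonneg : ∀ x, 0 ≤ σ x
  le_one : ∀ x, σ x ≤ 1

namespace IsOddProfile

theorem map_zero (h : IsOddProfile τ) : τ 0 = 0 := by
  have hzero := h.map_neg 0
  rw [neg_zero] at hzero
  linarith

theorem nonneg (h : IsOddProfile τ) {x : ℝ} (hx : 0 ≤ x) : 0 ≤ τ x :=
  h.map_zero.symm.trans_le (h.monotone hx)

theorem abs_apply (h : IsOddProfile τ) (x : ℝ) : |τ x| = τ |x| := by
  rcases le_total 0 x with hx | hx
  · rw [abs_of_nonneg hx, abs_of_nonneg (h.nonneg hx)]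
  · rw [abs_of_nonpos hx, h.map_neg, abs_of_nonpos]
    exact (h.monotone hx).trans_eq h.map_zero

theorem abs_le_one (h : IsOddProfile τ) (x : ℝ) : |τ x| ≤ 1 :=
  (h.abs_apply x).trans_le (h.le_one _)

theorem memLp_top (h : IsOddProfile τ) : MemLp τ ∞ :=
  memLp_top_of_bound h.monotone.measurable.aestronglyMeasurable 1 <|
    Eventually.of_forall h.abs_le_one

protected theorem sign : IsOddProfile Real.sign where
  map_neg x := Real.sign_neg
  monotone x y hxy := by
    rcases lt_trichotomy x 0 with hx | rfl | hx <;> rcases lt_trichotomy y 0 with hy | rfl | hy <;>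
      simp_all [Real.sign_of_neg, Real.sign_of_pos] <;> linarith
  le_one x := by
    rcases Real.sign_apply_eq x with hx | hx | hx <;> rw [hx] <;> norm_num

theorem le_sign (h : IsOddProfile τ) {x : ℝ} (hx : 0 ≤ x) : τ x ≤ Real.sign x := by
  rcases hx.eq_or_lt with rfl | hpos
  · rw [h.map_zero, Real.sign_zero]
  · exact (h.le_one x).trans_eq (Real.sign_of_pos hpos).symm

theorem greenOp (h : IsOddProfile τ) (hκ : 0 < κ) : IsOddProfile (greenOp κ τ) where
  map_neg x := by
    rw [← greenOp_comp_neg]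
    simp only [_root_.greenOp, h.map_neg, mul_neg, integral_neg]
  monotone := monotone_greenOp hκ h.memLp_top h.monotone
  le_one := greenOp_le hκ h.memLp_top h.le_one

theorem exists_tendsto {τ : ℕ → ℝ → ℝ} (h : ∀ n, IsOddProfile (τ n))
    (hanti : ∀ x, 0 ≤ x → Antitone fun n => τ n x) :
    ∃ τ', IsOddProfile τ' ∧ ∀ x, Tendsto (fun n => τ n x) atTop (𝓝 (τ' x)) := by
  have hpos (x : ℝ) (hx : 0 ≤ x) : ∃ l, Tendsto (fun n => τ n x) atTop (𝓝 l) :=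
    ⟨_, tendsto_atTop_ciInf (hanti x hx) ⟨0, Set.forall_mem_range.2 fun n => (h n).nonneg hx⟩⟩
  have hlim (x : ℝ) : ∃ l, Tendsto (fun n => τ n x) atTop (𝓝 l) := by
    rcases le_total 0 x with hx | hx
    · exact hpos x hx
    · obtain ⟨l, hl⟩ := hpos (-x) (neg_nonneg.2 hx)
      exact ⟨-l, hl.neg.congr fun n => by rw [(h n).map_neg, neg_neg]⟩
  choose τ' hτ' using hlim
  refine ⟨τ', ⟨fun x => ?_, fun x y hxy => ?_, fun x => ?_⟩, hτ'⟩
  · exact tendsto_nhds_unique (hτ' (-x)) ((hτ' x).neg.congr fun n => ((h n).map_neg x).symm)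
  · exact le_of_tendsto_of_tendsto' (hτ' x) (hτ' y) fun n => (h n).monotone hxy
  · exact le_of_tendsto' (hτ' x) fun n => (h n).le_one x

theorem exists_tendsto_atTop (h : IsOddProfile τ) :
    ∃ t, Tendsto τ atTop (𝓝 t) ∧ ∀ x, τ x ≤ t := by
  have hbdd : BddAbove (Set.range τ) := ⟨1, Set.forall_mem_range.2 h.le_one⟩
  exact ⟨_, tendsto_atTop_ciSup h.monotone hbdd, le_ciSup hbdd⟩

end IsOddProfile

namespace IsEvenProfile

theorem map_abs (h : IsEvenProfile σ) (x : ℝ) : σ |x| = σ x :=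
  (h.le_of_abs_le_abs _ _ (abs_abs x).le).antisymm (h.le_of_abs_le_abs _ _ (abs_abs x).ge)

theorem map_neg (h : IsEvenProfile σ) (x : ℝ) : σ (-x) = σ x := by
  rw [← h.map_abs, abs_neg, h.map_abs]

theorem abs_le_one (h : IsEvenProfile σ) (x : ℝ) : |σ x| ≤ 1 :=
  (abs_of_nonneg (h.nonneg x)).trans_le (h.le_one x)

theorem monotone_comp_max_zero (h : IsEvenProfile σ) : Monotone fun x => σ (max x 0) :=
  fun _ _ hxy => h.le_of_abs_le_abs _ _ <|
    abs_le_abs_of_nonneg (le_max_right _ _) (max_le_max_right 0 hxy)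

theorem measurable (h : IsEvenProfile σ) : Measurable σ := by
  convert h.monotone_comp_max_zero.measurable.comp measurable_abs using 1
  ext x
  rw [Function.comp_apply, max_eq_left (abs_nonneg x), h.map_abs]

theorem memLp_top (h : IsEvenProfile σ) : MemLp σ ∞ :=
  memLp_top_of_bound h.measurable.aestronglyMeasurable 1 (Eventually.of_forall h.abs_le_one)

protected theorem const {c : ℝ} (h₀ : 0 ≤ c) (h₁ : c ≤ 1) : IsEvenProfile fun _ => c :=
  ⟨fun _ _ _ => le_rfl, fun _ => h₀, fun _ => h₁⟩

theorem greenOp (h : IsEvenProfile σ) (hκ : 0 < κ) : IsEvenProfile (greenOp κ σ) where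
  le_of_abs_le_abs _ _ := greenOp_le_greenOp_of_abs_le_abs hκ h.memLp_top h.le_of_abs_le_abs
  nonneg := le_greenOp hκ h.memLp_top h.nonneg
  le_one := greenOp_le hκ h.memLp_top h.le_one

theorem exists_tendsto {σ : ℕ → ℝ → ℝ} (h : ∀ n, IsEvenProfile (σ n))
    (hanti : ∀ x, Antitone fun n => σ n x) :
    ∃ σ', IsEvenProfile σ' ∧ ∀ x, Tendsto (fun n => σ n x) atTop (𝓝 (σ' x)) := by
  have hlim (x : ℝ) : ∃ l, Tendsto (fun n => σ n x) atTop (𝓝 l) :=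
    ⟨_, tendsto_atTop_ciInf (hanti x) ⟨0, Set.forall_mem_range.2 fun n => (h n).nonneg x⟩⟩
  choose σ' hσ' using hlim
  refine ⟨σ', ⟨fun x y hxy => ?_, fun x => ?_, fun x => ?_⟩, hσ'⟩
  · exact le_of_tendsto_of_tendsto' (hσ' x) (hσ' y) fun n => (h n).le_of_abs_le_abs x y hxy
  · exact ge_of_tendsto' (hσ' x) fun n => (h n).nonneg x
  · exact le_of_tendsto' (hσ' x) fun n => (h n).le_one x

theorem exists_tendsto_atTop (h : IsEvenProfile σ) :
    ∃ s ∈ Set.Icc (0 : ℝ) 1, Tendsto σ atTop (𝓝 s) := by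
  have hlim := tendsto_atTop_ciSup h.monotone_comp_max_zero
    ⟨1, Set.forall_mem_range.2 fun x => h.le_one _⟩
  have hσ := hlim.congr' <| (eventually_ge_atTop 0).mono fun x hx => by rw [max_eq_left hx]
  exact ⟨_, ⟨ge_of_tendsto' hσ h.nonneg, le_of_tendsto' hσ h.le_one⟩, hσ⟩

end IsEvenProfile

/-- A pair of nonlinearities on `[-1, 1] × [0, 1]` which is nondecreasing on `[0, 1]²`, with `h₁`
odd and `h₂` even in the first variable, and which maps `(1, 1)` to itself. Such a pair maps pairs
of an odd and an even profile to pairs of the same kind. -/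
structure IsCooperativePair (h₁ h₂ : ℝ × ℝ → ℝ) : Prop where
  continuous_fst : Continuous h₁
  continuous_snd : Continuous h₂
  fst_neg : ∀ t s, h₁ (-t, s) = -h₁ (t, s)
  snd_neg : ∀ t s, h₂ (-t, s) = h₂ (t, s)
  monotoneOn_fst : MonotoneOn h₁ (Set.Icc 0 1)
  monotoneOn_snd : MonotoneOn h₂ (Set.Icc 0 1)
  fst_one : h₁ 1 = 1
  snd_one : h₂ 1 = 1
  snd_zero_nonneg : 0 ≤ h₂ 0

theorem IsOddProfile.mem_Icc (hτ : IsOddProfile τ) (hσ : IsEvenProfile σ) {x : ℝ} (hx : 0 ≤ x) :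
    (τ x, σ x) ∈ Set.Icc (0 : ℝ × ℝ) 1 :=
  ⟨⟨hτ.nonneg hx, hσ.nonneg x⟩, ⟨hτ.le_one x, hσ.le_one x⟩⟩

/-- One step of the monotone iteration for `τ = (1 - κ⁻² d²/dx²)⁻¹ h₁(τ, σ)`,
`σ = (1 - κ⁻² d²/dx²)⁻¹ h₂(τ, σ)`. -/
noncomputable def cooperativeStep (κ : ℝ) (h₁ h₂ : ℝ × ℝ → ℝ) (q : (ℝ → ℝ) × (ℝ → ℝ)) :
    (ℝ → ℝ) × (ℝ → ℝ) :=
  (greenOp κ fun x => h₁ (q.1 x, q.2 x), greenOp κ fun x => h₂ (q.1 x, q.2 x))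

/-- The monotone iteration started at the largest pair of profiles. -/
noncomputable def cooperativeIterate (κ : ℝ) (h₁ h₂ : ℝ × ℝ → ℝ) (n : ℕ) : (ℝ → ℝ) × (ℝ → ℝ) :=
  (cooperativeStep κ h₁ h₂)^[n] (Real.sign, fun _ => 1)

theorem cooperativeIterate_succ (κ : ℝ) (h₁ h₂ : ℝ × ℝ → ℝ) (n : ℕ) :
    cooperativeIterate κ h₁ h₂ (n + 1) = cooperativeStep κ h₁ h₂ (cooperativeIterate κ h₁ h₂ n) :=
  Function.iterate_succ_apply' _ n _

namespace IsCooperativePair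

theorem isOddProfile_comp (H : IsCooperativePair h₁ h₂) (hτ : IsOddProfile τ)
    (hσ : IsEvenProfile σ) : IsOddProfile fun x => h₁ (τ x, σ x) := by
  have hodd (x : ℝ) : h₁ (τ (-x), σ (-x)) = -h₁ (τ x, σ x) := by
    rw [hτ.map_neg, hσ.map_neg, H.fst_neg]
  have hmono : Monotone fun x => h₁ (τ x, σ x) := by
    refine monotone_of_odd_of_monotoneOn_nonneg hodd fun x hx y hy hxy => ?_
    refine H.monotoneOn_fst (hτ.mem_Icc hσ hx) (hτ.mem_Icc hσ hy) ⟨hτ.monotone hxy, ?_⟩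
    exact hσ.le_of_abs_le_abs _ _ (abs_le_abs_of_nonneg hx hxy)
  refine ⟨hodd, hmono, fun x => (hmono (le_abs_self x)).trans ?_⟩
  have hmem := hτ.mem_Icc hσ (abs_nonneg x)
  exact (H.monotoneOn_fst hmem ⟨zero_le_one, le_rfl⟩ hmem.2).trans_eq H.fst_one

theorem snd_apply_abs (H : IsCooperativePair h₁ h₂) (hτ : IsOddProfile τ)
    (hσ : IsEvenProfile σ) (x : ℝ) : h₂ (τ |x|, σ |x|) = h₂ (τ x, σ x) := by
  rw [hσ.map_abs, ← hτ.abs_apply]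
  rcases abs_choice (τ x) with h | h <;> rw [h]
  rw [H.snd_neg]

theorem isEvenProfile_comp (H : IsCooperativePair h₁ h₂) (hτ : IsOddProfile τ)
    (hσ : IsEvenProfile σ) : IsEvenProfile fun x => h₂ (τ x, σ x) := by
  refine ⟨fun x y hxy => ?_, fun x => ?_, fun x => ?_⟩ <;>
    simp only [← H.snd_apply_abs hτ hσ x]
  · rw [← H.snd_apply_abs hτ hσ y]
    refine H.monotoneOn_snd (hτ.mem_Icc hσ (abs_nonneg x)) (hτ.mem_Icc hσ (abs_nonneg y))
      ⟨hτ.monotone hxy, hσ.le_of_abs_le_abs _ _ ?_⟩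
    rwa [abs_abs, abs_abs]
  · have hmem := hτ.mem_Icc hσ (abs_nonneg x)
    exact H.snd_zero_nonneg.trans (H.monotoneOn_snd ⟨le_rfl, zero_le_one⟩ hmem hmem.1)
  · have hmem := hτ.mem_Icc hσ (abs_nonneg x)
    exact (H.monotoneOn_snd hmem ⟨zero_le_one, le_rfl⟩ hmem.2).trans_eq H.snd_one

theorem greenOp_fst_mono (H : IsCooperativePair h₁ h₂) (hκ : 0 < κ) (hτ : IsOddProfile τ)
    (hσ : IsEvenProfile σ) (hτ' : IsOddProfile τ') (hσ' : IsEvenProfile σ')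
    (hττ' : ∀ x, 0 ≤ x → τ x ≤ τ' x) (hσσ' : ∀ x, σ x ≤ σ' x) {x : ℝ} (hx : 0 ≤ x) :
    greenOp κ (fun x => h₁ (τ x, σ x)) x ≤ greenOp κ (fun x => h₁ (τ' x, σ' x)) x := by
  have hp := H.isOddProfile_comp hτ hσ
  have hp' := H.isOddProfile_comp hτ' hσ'
  exact greenOp_mono_of_odd hκ hp.memLp_top hp'.memLp_top hp.map_neg hp'.map_neg (fun y hy =>
    H.monotoneOn_fst (hτ.mem_Icc hσ hy) (hτ'.mem_Icc hσ' hy) ⟨hττ' y hy, hσσ' y⟩) hx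

theorem greenOp_snd_mono (H : IsCooperativePair h₁ h₂) (hκ : 0 < κ) (hτ : IsOddProfile τ)
    (hσ : IsEvenProfile σ) (hτ' : IsOddProfile τ') (hσ' : IsEvenProfile σ')
    (hττ' : ∀ x, 0 ≤ x → τ x ≤ τ' x) (hσσ' : ∀ x, σ x ≤ σ' x) (x : ℝ) :
    greenOp κ (fun x => h₂ (τ x, σ x)) x ≤ greenOp κ (fun x => h₂ (τ' x, σ' x)) x := by
  refine greenOp_mono hκ (H.isEvenProfile_comp hτ hσ).memLp_top
    (H.isEvenProfile_comp hτ' hσ').memLp_top (fun y => ?_) x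
  rw [← H.snd_apply_abs hτ hσ, ← H.snd_apply_abs hτ' hσ']
  exact H.monotoneOn_snd (hτ.mem_Icc hσ (abs_nonneg y)) (hτ'.mem_Icc hσ' (abs_nonneg y))
    ⟨hττ' _ (abs_nonneg y), hσσ' _⟩

theorem isProfile_iterate (H : IsCooperativePair h₁ h₂) (hκ : 0 < κ) (n : ℕ) :
    IsOddProfile (cooperativeIterate κ h₁ h₂ n).1 ∧
      IsEvenProfile (cooperativeIterate κ h₁ h₂ n).2 := by
  induction n with
  | zero => exact ⟨.sign, .const zero_le_one le_rfl⟩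
  | succ n ih =>
    rw [cooperativeIterate_succ]
    exact ⟨(H.isOddProfile_comp ih.1 ih.2).greenOp hκ, (H.isEvenProfile_comp ih.1 ih.2).greenOp hκ⟩

theorem iterate_succ_le (H : IsCooperativePair h₁ h₂) (hκ : 0 < κ) (n : ℕ) :
    (∀ x, 0 ≤ x →
      (cooperativeIterate κ h₁ h₂ (n + 1)).1 x ≤ (cooperativeIterate κ h₁ h₂ n).1 x) ∧
    ∀ x, (cooperativeIterate κ h₁ h₂ (n + 1)).2 x ≤ (cooperativeIterate κ h₁ h₂ n).2 x := by
  have hp := H.isProfile_iterate hκ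
  induction n with
  | zero => exact ⟨fun x hx => (hp 1).1.le_sign hx, (hp 1).2.le_one⟩
  | succ n ih =>
    rw [cooperativeIterate_succ κ h₁ h₂ (n + 1)]
    refine ⟨fun x hx => ?_, fun x => ?_⟩ <;> conv_rhs => rw [cooperativeIterate_succ]
    · exact H.greenOp_fst_mono hκ (hp (n + 1)).1 (hp (n + 1)).2 (hp n).1 (hp n).2 ih.1 ih.2 hx
    · exact H.greenOp_snd_mono hκ (hp (n + 1)).1 (hp (n + 1)).2 (hp n).1 (hp n).2 ih.1 ih.2 x

theorem le_iterate_fst (H : IsCooperativePair h₁ h₂) (hκ : 0 < κ) (hφ : IsOddProfile φ)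
    (hsub : ∀ x, 0 ≤ x → φ x ≤ greenOp κ (fun y => h₁ (φ y, 0)) x) (n : ℕ) {x : ℝ} (hx : 0 ≤ x) :
    φ x ≤ (cooperativeIterate κ h₁ h₂ n).1 x := by
  induction n generalizing x with
  | zero => exact hφ.le_sign hx
  | succ n ih =>
    obtain ⟨hodd, heven⟩ := H.isProfile_iterate hκ n
    rw [cooperativeIterate_succ]
    exact (hsub x hx).trans (H.greenOp_fst_mono hκ hφ (.const le_rfl zero_le_one) hodd heven
      (fun _ => ih) heven.nonneg hx)

theorem iterate_constraint (H : IsCooperativePair h₁ h₂) (hκ : 0 < κ) {D β₀ β₁ : ℝ} (hD : 0 ≤ D)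
    (hDβ : D ≤ β₀ + β₁) (hconstraint : ∀ t s, (t, s) ∈ Set.Icc (0 : ℝ × ℝ) 1 →
      D * t ≤ β₀ + β₁ * s → D * h₁ (t, s) ≤ β₀ + β₁ * h₂ (t, s)) (n : ℕ) (x : ℝ) :
    D * (cooperativeIterate κ h₁ h₂ n).1 x ≤ β₀ + β₁ * (cooperativeIterate κ h₁ h₂ n).2 x := by
  induction n generalizing x with
  | zero =>
    change D * Real.sign x ≤ β₀ + β₁ * 1
    linarith [mul_le_of_le_one_right hD (IsOddProfile.sign.le_one x)]
  | succ n ih =>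
    obtain ⟨hodd, heven⟩ := H.isProfile_iterate hκ n
    rw [cooperativeIterate_succ]
    generalize cooperativeIterate κ h₁ h₂ n = q at *
    have hfst := H.isOddProfile_comp hodd heven
    have hsnd := H.isEvenProfile_comp hodd heven
    have hle (y : ℝ) : D * h₁ (q.1 y, q.2 y) ≤ β₀ + β₁ * h₂ (q.1 y, q.2 y) := calc
      D * h₁ (q.1 y, q.2 y) ≤ D * h₁ (q.1 |y|, q.2 |y|) :=
        mul_le_mul_of_nonneg_left (hfst.monotone (le_abs_self y)) hD
      _ ≤ β₀ + β₁ * h₂ (q.1 |y|, q.2 |y|) :=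
        hconstraint _ _ (hodd.mem_Icc heven (abs_nonneg y)) (ih |y|)
      _ = β₀ + β₁ * h₂ (q.1 y, q.2 y) := by rw [H.snd_apply_abs hodd heven]
    have hgreen := greenOp_mono hκ (hfst.memLp_top.const_mul D)
      ((memLp_top_const β₀).add (hsnd.memLp_top.const_mul β₁)) hle x
    have hmul : greenOp κ (fun y => D * h₁ (q.1 y, q.2 y)) x =
        D * greenOp κ (fun y => h₁ (q.1 y, q.2 y)) x := by
      simpa only [zero_add] using greenOp_const_add_const_mul hκ hfst.memLp_top 0 D x
    rw [hmul] at hgreen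
    exact hgreen.trans_eq (greenOp_const_add_const_mul hκ hsnd.memLp_top β₀ β₁ x)

theorem exists_fixed_profile (H : IsCooperativePair h₁ h₂) (hκ : 0 < κ) {D β₀ β₁ : ℝ} (hD : 0 ≤ D)
    (hDβ : D ≤ β₀ + β₁) (hconstraint : ∀ t s, (t, s) ∈ Set.Icc (0 : ℝ × ℝ) 1 →
      D * t ≤ β₀ + β₁ * s → D * h₁ (t, s) ≤ β₀ + β₁ * h₂ (t, s))
    (hφ : IsOddProfile φ) (hsub : ∀ x, 0 ≤ x → φ x ≤ greenOp κ (fun y => h₁ (φ y, 0)) x) :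
    ∃ τ σ : ℝ → ℝ, IsOddProfile τ ∧ IsEvenProfile σ ∧ (∀ x, D * τ x ≤ β₀ + β₁ * σ x) ∧
      (∀ x, 0 ≤ x → φ x ≤ τ x) ∧ τ = greenOp κ (fun x => h₁ (τ x, σ x)) ∧
      σ = greenOp κ fun x => h₂ (τ x, σ x) := by
  have hp := H.isProfile_iterate hκ
  obtain ⟨τ, hτ, hτlim⟩ := IsOddProfile.exists_tendsto (fun n => (hp n).1) fun x hx =>
    antitone_nat_of_succ_le fun n => (H.iterate_succ_le hκ n).1 x hx
  obtain ⟨σ, hσ, hσlim⟩ := IsEvenProfile.exists_tendsto (fun n => (hp n).2) fun x =>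
    antitone_nat_of_succ_le fun n => (H.iterate_succ_le hκ n).2 x
  have hlim {h : ℝ × ℝ → ℝ} (hcont : Continuous h) (y : ℝ) :=
    (hcont.tendsto (τ y, σ y)).comp ((hτlim y).prodMk_nhds (hσlim y))
  refine ⟨τ, σ, hτ, hσ, fun x => ?_, fun x hx => ?_, funext fun x => ?_, funext fun x => ?_⟩
  · exact le_of_tendsto_of_tendsto' ((hτlim x).const_mul D) (((hσlim x).const_mul β₁).const_add β₀)
      fun n => H.iterate_constraint hκ hD hDβ hconstraint n x
  · exact ge_of_tendsto' (hτlim x) fun n => H.le_iterate_fst hκ hφ hsub n hx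
  · refine tendsto_nhds_unique ((hτlim x).comp (tendsto_add_atTop_nat 1)) ?_
    simp only [Function.comp_def, cooperativeIterate_succ]
    have hprofile (n : ℕ) := H.isOddProfile_comp (hp n).1 (hp n).2
    exact tendsto_greenOp_of_tendsto hκ (fun n => (hprofile n).monotone.measurable)
      (fun n => (hprofile n).abs_le_one) (hlim H.continuous_fst) x
  · refine tendsto_nhds_unique ((hσlim x).comp (tendsto_add_atTop_nat 1)) ?_
    simp only [Function.comp_def, cooperativeIterate_succ]
    have hprofile (n : ℕ) := H.isEvenProfile_comp (hp n).1 (hp n).2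
    exact tendsto_greenOp_of_tendsto hκ (fun n => (hprofile n).measurable)
      (fun n => (hprofile n).abs_le_one) (hlim H.continuous_snd) x

theorem contDiff_two_of_eq_greenOp (H : IsCooperativePair h₁ h₂) (hκ : 0 < κ)
    (hτ : IsOddProfile τ) (hσ : IsEvenProfile σ) (hτ_eq : τ = greenOp κ fun x => h₁ (τ x, σ x))
    (hσ_eq : σ = greenOp κ fun x => h₂ (τ x, σ x)) :
    (ContDiff ℝ 2 τ ∧ ∀ x, deriv (deriv τ) x = κ ^ 2 * (τ x - h₁ (τ x, σ x))) ∧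
      ContDiff ℝ 2 σ ∧ ∀ x, deriv (deriv σ) x = κ ^ 2 * (σ x - h₂ (τ x, σ x)) := by
  have hmem₁ := (H.isOddProfile_comp hτ hσ).memLp_top
  have hmem₂ := (H.isEvenProfile_comp hτ hσ).memLp_top
  have hcontτ : Continuous τ := hτ_eq ▸ continuous_greenOp hκ hmem₁
  have hcontσ : Continuous σ := hσ_eq ▸ continuous_greenOp hκ hmem₂
  have hfst := greenOp_contDiff_two hκ hmem₁ (H.continuous_fst.comp (hcontτ.prodMk hcontσ))
  have hsnd := greenOp_contDiff_two hκ hmem₂ (H.continuous_snd.comp (hcontτ.prodMk hcontσ))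
  rw [← hτ_eq] at hfst
  rw [← hσ_eq] at hsnd
  exact ⟨hfst, hsnd⟩

theorem eq_of_tendsto_of_eq_greenOp (H : IsCooperativePair h₁ h₂) (hκ : 0 < κ)
    (hτ : IsOddProfile τ) (hσ : IsEvenProfile σ) (hτ_eq : τ = greenOp κ fun x => h₁ (τ x, σ x))
    (hσ_eq : σ = greenOp κ fun x => h₂ (τ x, σ x)) {t s : ℝ} (ht : Tendsto τ atTop (𝓝 t))
    (hs : Tendsto σ atTop (𝓝 s)) : t = h₁ (t, s) ∧ s = h₂ (t, s) := by
  have hodd := H.isOddProfile_comp hτ hσ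
  have heven := H.isEvenProfile_comp hτ hσ
  have hfst := tendsto_greenOp_atTop hκ hodd.monotone.measurable hodd.abs_le_one
    ((H.continuous_fst.tendsto (t, s)).comp (ht.prodMk_nhds hs))
  have hsnd := tendsto_greenOp_atTop hκ heven.measurable heven.abs_le_one
    ((H.continuous_snd.tendsto (t, s)).comp (ht.prodMk_nhds hs))
  rw [← hτ_eq] at hfst
  rw [← hσ_eq] at hsnd
  exact ⟨tendsto_nhds_unique ht hfst, tendsto_nhds_unique hs hsnd⟩

end IsCooperativePair

end CooperativeSystem

/-! ### Existence of a symmetric front -/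

section TanhProfile

variable {θ k : ℝ}

theorem hasDerivAt_const_mul_tanh_mul (θ k x : ℝ) :
    HasDerivAt (fun y => θ * Real.tanh (k * y)) (θ * k * (1 - Real.tanh (k * x) ^ 2)) x := by
  have hlin : HasDerivAt (fun y => k * y) k x := by
    simpa only [id, mul_one] using (hasDerivAt_id x).const_mul k
  have hcosh : Real.cosh (k * x) ≠ 0 := (Real.cosh_pos _).ne'
  simp only [Real.tanh_eq_sinh_div_cosh]
  refine ((hlin.sinh.fun_div hlin.cosh hcosh).const_mul θ).congr_deriv ?_
  field_simp

theorem contDiff_two_const_mul_tanh_mul (θ k : ℝ) :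
    ContDiff ℝ 2 (fun y => θ * Real.tanh (k * y)) ∧
      ∀ x, deriv (deriv fun y => θ * Real.tanh (k * y)) x =
        2 * k ^ 2 * (θ * Real.tanh (k * x)) * (Real.tanh (k * x) ^ 2 - 1) := by
  have htanh (x : ℝ) := hasDerivAt_const_mul_tanh_mul 1 k x
  simp only [one_mul] at htanh
  have hfst := hasDerivAt_const_mul_tanh_mul θ k
  have hsnd (x : ℝ) : HasDerivAt (fun y => θ * k * (1 - Real.tanh (k * y) ^ 2))
      (2 * k ^ 2 * (θ * Real.tanh (k * x)) * (Real.tanh (k * x) ^ 2 - 1)) x := by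
    refine ((((htanh x).fun_pow 2).const_sub 1).const_mul (θ * k)).congr_deriv ?_
    ring
  have hcont : Continuous fun x => Real.tanh (k * x) :=
    continuous_iff_continuousAt.2 fun x => (htanh x).continuousAt
  refine ⟨contDiff_two_of_hasDerivAt hfst hsnd (by fun_prop), fun x => ?_⟩
  rw [funext fun y => (hfst y).deriv, (hsnd x).deriv]

theorem IsOddProfile.const_mul_tanh_mul (hθ : 0 ≤ θ) (hθ₁ : θ ≤ 1) (hk : 0 ≤ k) :
    IsOddProfile fun x => θ * Real.tanh (k * x) where
  map_neg x := by rw [mul_neg, Real.tanh_neg, mul_neg]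
  monotone := by
    refine monotone_of_hasDerivAt_nonneg (hasDerivAt_const_mul_tanh_mul θ k) fun x => ?_
    exact mul_nonneg (mul_nonneg hθ hk) (sub_nonneg.2 (Real.tanh_sq_lt_one _).le)
  le_one x := (mul_le_of_le_one_right hθ (Real.tanh_lt_one _).le).trans hθ₁

end TanhProfile

section LipschitzOnWith

open scoped NNReal

variable {f : ℝ × ℝ → ℝ} {K : ℝ≥0} {L : ℝ}

theorem monotoneOn_fst_sub_div_of_lipschitzOnWith (hf : LipschitzOnWith K f (Set.Icc 0 1))
    (hanti : ∀ t ∈ Set.Icc (0 : ℝ) 1, AntitoneOn (fun s => f (t, s)) (Set.Icc 0 1)) (hL : 0 < L)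
    (hKL : K ≤ L) : MonotoneOn (fun p => p.1 - f p / L) (Set.Icc 0 1) := by
  rintro ⟨t, s⟩ ⟨⟨ht₀, hs₀⟩, ⟨ht₁, hs₁⟩⟩ ⟨t', s'⟩ ⟨⟨ht'₀, hs'₀⟩, ⟨ht'₁, hs'₁⟩⟩ ⟨htt', hss'⟩
  simp only [Prod.fst_zero, Prod.snd_zero, Prod.fst_one, Prod.snd_one] at *
  have hanti' : f (t', s') ≤ f (t', s) := hanti t' ⟨ht'₀, ht'₁⟩ ⟨hs₀, hs₁⟩ ⟨hs'₀, hs'₁⟩ hss'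
  have hlip : f (t', s) - f (t, s) ≤ K * (t' - t) := by
    have hdist := hf.dist_le_mul (t', s) ⟨⟨ht'₀, hs₀⟩, ht'₁, hs₁⟩ (t, s) ⟨⟨ht₀, hs₀⟩, ht₁, hs₁⟩
    rw [Prod.dist_eq, dist_self, max_eq_left dist_nonneg, Real.dist_eq, Real.dist_eq,
      abs_of_nonneg (sub_nonneg.2 htt')] at hdist
    exact (le_abs_self _).trans hdist
  have hKL' : K * (t' - t) ≤ L * (t' - t) := mul_le_mul_of_nonneg_right hKL (sub_nonneg.2 htt')
  have hdiv : (f (t', s') - f (t, s)) / L ≤ t' - t := by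
    rw [div_le_iff₀' hL]
    linarith
  rw [sub_div] at hdiv
  linarith

theorem monotoneOn_snd_sub_div_of_lipschitzOnWith (hf : LipschitzOnWith K f (Set.Icc 0 1))
    (hanti : ∀ s ∈ Set.Icc (0 : ℝ) 1, AntitoneOn (fun t => f (t, s)) (Set.Icc 0 1)) (hL : 0 < L)
    (hKL : K ≤ L) : MonotoneOn (fun p => p.2 - f p / L) (Set.Icc 0 1) := by
  have hswap : Set.MapsTo Prod.swap (Set.Icc (0 : ℝ × ℝ) 1) (Set.Icc 0 1) :=
    fun _ hp => ⟨hp.1.symm, hp.2.symm⟩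
  have hlip : LipschitzOnWith K (fun p => f (Prod.swap p)) (Set.Icc 0 1) := by
    have hswap_lip := (LipschitzWith.prod_snd (α := ℝ) (β := ℝ)).prodMk LipschitzWith.prod_fst
    have hcomp := hf.comp hswap_lip.lipschitzOnWith hswap
    rwa [max_self, mul_one] at hcomp
  exact (monotoneOn_fst_sub_div_of_lipschitzOnWith hlip hanti hL hKL).comp
    (fun p _ q _ hpq => Prod.swap_le_swap.2 hpq) hswap

end LipschitzOnWith

section FrontData

/-- Data for a front of the mode system `s'' = modeRhs A B S D s d`, `d'' = modeRhs A B D S d s`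
from `(S, -D)` to `(S, D)`. At the zero of the odd component `d`, the even component `s` takes a
value between `S` and `c`, where `(c, 0)` is the equilibrium on the axis `d = 0`. -/
structure IsFrontData (A B S D c : ℝ) : Prop where
  abs_B_lt : |B| < A
  D_pos : 0 < D
  D_lt_S : D < S
  c_pos : 0 < c
  c_eq : A * (c ^ 2 - S ^ 2) = B * D ^ 2

theorem exists_isFrontData {A B S D : ℝ} (hAB : |B| < A) (hD : 0 < D) (hDS : D < S) :
    ∃ c, IsFrontData A B S D c := by
  have hA : 0 < A := (abs_nonneg B).trans_lt hAB
  have hpos : 0 < S ^ 2 + B * D ^ 2 / A := by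
    have hle : -(D ^ 2) ≤ B * D ^ 2 / A := by
      rw [le_div_iff₀ hA]
      nlinarith [mul_nonneg (neg_le_iff_add_nonneg.1 (abs_lt.1 hAB).1.le) (sq_nonneg D)]
    nlinarith
  refine ⟨√(S ^ 2 + B * D ^ 2 / A), hAB, hD, hDS, Real.sqrt_pos.2 hpos, ?_⟩
  rw [Real.sq_sqrt hpos.le]
  field_simp
  ring

/-- The sum component as an affine function of a parameter `σ ∈ [0, 1]`. -/
def frontSum (c S σ : ℝ) : ℝ :=
  c + (S - c) * σ

/-- The equation for the difference in the variables `d = D τ`, `s = frontSum c S σ`. -/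
def frontDiffRhs (A B S D c : ℝ) (p : ℝ × ℝ) : ℝ :=
  p.1 * (A * D ^ 2 * (p.1 ^ 2 - 1) + B * (frontSum c S p.2 ^ 2 - S ^ 2))

/-- The equation for the sum in the variables `d = D τ`, `s = frontSum c S σ`, with the common
factor `S - c` removed. -/
def frontSumRhs (A S c : ℝ) (p : ℝ × ℝ) : ℝ :=
  A * frontSum c S p.2 * (p.2 * (frontSum c S p.2 + c) - (S + c) * p.1 ^ 2)

theorem mul_frontDiffRhs (A B S D c τ σ : ℝ) :
    D * frontDiffRhs A B S D c (τ, σ) = modeRhs A B D S (D * τ) (frontSum c S σ) := by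
  simp only [frontDiffRhs, modeRhs]
  ring

theorem eq_of_modeRhs_eq_zero {A B P Q p q : ℝ} (hAB : |B| < A) (hP : 0 < P) (hQ : 0 < Q)
    (hp : 0 < p) (hq : 0 < q) (hpq : modeRhs A B P Q p q = 0) (hqp : modeRhs A B Q P q p = 0) :
    p = P ∧ q = Q := by
  have hdet : A ^ 2 - B ^ 2 ≠ 0 := (sub_pos.2 (sq_lt_sq.2 (hAB.trans_le (le_abs_self A)))).ne'
  have h₁ := (mul_eq_zero.1 hpq).resolve_left hp.ne'
  have h₂ := (mul_eq_zero.1 hqp).resolve_left hq.ne'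
  have hp' : (A ^ 2 - B ^ 2) * (p ^ 2 - P ^ 2) = 0 := by linear_combination A * h₁ - B * h₂
  have hq' : (A ^ 2 - B ^ 2) * (q ^ 2 - Q ^ 2) = 0 := by linear_combination A * h₂ - B * h₁
  exact ⟨(sq_eq_sq₀ hp.le hP.le).1 (sub_eq_zero.1 ((mul_eq_zero.1 hp').resolve_left hdet)),
    (sq_eq_sq₀ hq.le hQ.le).1 (sub_eq_zero.1 ((mul_eq_zero.1 hq').resolve_left hdet))⟩

theorem modeRhs_sub_modeRhs_le {A B P Q p q : ℝ} (hAB : |B| ≤ A) (hQP : Q ^ 2 ≤ P ^ 2) (hq : 0 ≤ q)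
    (hqp : q ≤ p) : modeRhs A B P Q p q - modeRhs A B Q P q p ≤ 4 * A * p ^ 2 * (p - q) := by
  have hB := abs_le.1 hAB
  have hidentity : modeRhs A B P Q p q - modeRhs A B Q P q p =
      (p - q) * (A * (p ^ 2 + p * q + q ^ 2) - B * (p * q)) -
        (p - q) * ((A + B) * (P ^ 2 + Q ^ 2)) / 2 - (p + q) * ((A - B) * (P ^ 2 - Q ^ 2)) / 2 := by
    simp only [modeRhs]
    ring
  have hp : 0 ≤ p := hq.trans hqp
  have hsum : 0 ≤ (p - q) * ((A + B) * (P ^ 2 + Q ^ 2)) :=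
    mul_nonneg (sub_nonneg.2 hqp) (mul_nonneg (by linarith) (by positivity))
  have hdiff : 0 ≤ (p + q) * ((A - B) * (P ^ 2 - Q ^ 2)) :=
    mul_nonneg (add_nonneg hp hq) (mul_nonneg (sub_nonneg.2 hB.2) (sub_nonneg.2 hQP))
  have hfactor : A * (p ^ 2 + p * q + q ^ 2) - B * (p * q) ≤ 4 * A * p ^ 2 := by
    have hA : 0 ≤ A := (abs_nonneg B).trans hAB
    have hpq : A * (p * q) ≤ A * p ^ 2 := by
      rw [sq]
      gcongr
    have hqq : A * q ^ 2 ≤ A * p ^ 2 := by gcongr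
    have hBpq : 0 ≤ (B + A) * (p * q) :=
      mul_nonneg (neg_le_iff_add_nonneg.1 hB.1) (mul_nonneg hp hq)
    linarith
  nlinarith [mul_le_mul_of_nonneg_left hfactor (sub_nonneg.2 hqp)]

namespace IsFrontData

variable {A B S D c : ℝ}

theorem mul_frontSumRhs (h : IsFrontData A B S D c) (τ σ : ℝ) :
    (S - c) * frontSumRhs A S c (τ, σ) = modeRhs A B S D (frontSum c S σ) (D * τ) := by
  simp only [frontSumRhs, modeRhs, frontSum]
  linear_combination (c + (S - c) * σ) * (τ ^ 2 - 1) * h.c_eq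

theorem A_pos (h : IsFrontData A B S D c) : 0 < A :=
  (abs_nonneg B).trans_lt h.abs_B_lt

theorem S_pos (h : IsFrontData A B S D c) : 0 < S :=
  h.D_pos.trans h.D_lt_S

theorem frontSum_pos (h : IsFrontData A B S D c) {σ : ℝ} (hσ : σ ∈ Set.Icc (0 : ℝ) 1) :
    0 < frontSum c S σ := by
  rcases hσ.2.eq_or_lt with rfl | hlt
  · simpa only [frontSum, mul_one, add_sub_cancel] using h.S_pos
  · have := mul_pos h.c_pos (sub_pos.2 hlt)
    have := mul_nonneg h.S_pos.le hσ.1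
    rw [frontSum]
    linarith

theorem frontSum_le_add (h : IsFrontData A B S D c) {σ : ℝ} (hσ : σ ∈ Set.Icc (0 : ℝ) 1) :
    frontSum c S σ ≤ c + S := by
  have := mul_nonneg h.c_pos.le hσ.1
  have := mul_le_of_le_one_right h.S_pos.le hσ.2
  rw [frontSum]
  linarith

theorem B_mul_sub_nonpos (h : IsFrontData A B S D c) : B * (S - c) ≤ 0 := by
  have hkey : A * (S + c) * (B * (S - c)) = -(B ^ 2 * D ^ 2) := by
    linear_combination -B * h.c_eq
  refine nonpos_of_mul_nonpos_right (hkey.trans_le ?_) (mul_pos h.A_pos (add_pos h.S_pos h.c_pos))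
  exact neg_nonpos.2 (by positivity)

theorem antitoneOn_frontDiffRhs (h : IsFrontData A B S D c) {τ : ℝ} (hτ : 0 ≤ τ) :
    AntitoneOn (fun σ => frontDiffRhs A B S D c (τ, σ)) (Set.Icc 0 1) := by
  intro σ hσ σ' hσ' hle
  have hsum := add_pos (h.frontSum_pos hσ) (h.frontSum_pos hσ')
  have hdiff : B * (frontSum c S σ' ^ 2 - frontSum c S σ ^ 2) =
      B * (S - c) * ((σ' - σ) * (frontSum c S σ + frontSum c S σ')) := by
    simp only [frontSum]
    ring
  have hnonpos := mul_nonpos_of_nonpos_of_nonneg h.B_mul_sub_nonpos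
    (mul_nonneg (sub_nonneg.2 hle) hsum.le)
  exact mul_le_mul_of_nonneg_left (by linarith) hτ

theorem antitoneOn_frontSumRhs (h : IsFrontData A B S D c) {σ : ℝ} (hσ : σ ∈ Set.Icc (0 : ℝ) 1) :
    AntitoneOn (fun τ => frontSumRhs A S c (τ, σ)) (Set.Icc 0 1) := by
  intro τ hτ τ' _ hle
  have hSc : 0 ≤ S + c := (add_pos h.S_pos h.c_pos).le
  have hτ₀ : 0 ≤ τ := hτ.1
  exact mul_le_mul_of_nonneg_left (by gcongr) (mul_pos h.A_pos (h.frontSum_pos hσ)).le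

theorem exists_isCooperativePair (h : IsFrontData A B S D c) : ∃ κ > 0,
    4 * A * (c + S) ^ 2 ≤ κ ^ 2 ∧
      IsCooperativePair (fun p => p.1 - frontDiffRhs A B S D c p / κ ^ 2)
        (fun p => p.2 - frontSumRhs A S c p / κ ^ 2) := by
  have hdiff : ContDiff ℝ 1 (frontDiffRhs A B S D c) := by
    unfold frontDiffRhs frontSum
    fun_prop
  have hsum : ContDiff ℝ 1 (frontSumRhs A S c) := by
    unfold frontSumRhs frontSum
    fun_prop
  obtain ⟨K₁, hK₁⟩ := hdiff.locallyLipschitz.locallyLipschitzOn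
    |>.exists_lipschitzOnWith_of_compact (s := Set.Icc 0 1) isCompact_Icc
  obtain ⟨K₂, hK₂⟩ := hsum.locallyLipschitz.locallyLipschitzOn
    |>.exists_lipschitzOnWith_of_compact (s := Set.Icc 0 1) isCompact_Icc
  have hA := h.A_pos
  obtain ⟨κ, hκ, hκ_sq⟩ : ∃ κ > 0, κ ^ 2 = 1 + K₁ + K₂ + 4 * A * (c + S) ^ 2 :=
    ⟨√(1 + K₁ + K₂ + 4 * A * (c + S) ^ 2), by positivity, Real.sq_sqrt (by positivity)⟩
  have hcS : 0 ≤ 4 * A * (c + S) ^ 2 := by positivity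
  refine ⟨κ, hκ, by linarith [K₁.coe_nonneg, K₂.coe_nonneg], ?_⟩
  exact
  { continuous_fst := continuous_fst.sub (hdiff.continuous.div_const _)
    continuous_snd := continuous_snd.sub (hsum.continuous.div_const _)
    fst_neg := fun t s => by simp only [frontDiffRhs]; ring
    snd_neg := fun t s => by simp only [frontSumRhs, neg_sq]
    monotoneOn_fst := monotoneOn_fst_sub_div_of_lipschitzOnWith hK₁
      (fun _ ht => h.antitoneOn_frontDiffRhs ht.1) (by positivity) (by linarith [K₂.coe_nonneg])
    monotoneOn_snd := monotoneOn_snd_sub_div_of_lipschitzOnWith hK₂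
      (fun _ hs => h.antitoneOn_frontSumRhs hs) (by positivity) (by linarith [K₁.coe_nonneg])
    fst_one := by simp [frontDiffRhs, frontSum]
    snd_one := by simp [frontSumRhs, frontSum]
    snd_zero_nonneg := by simp [frontSumRhs] }

theorem exists_isOddProfile_eq_frontDiffRhs (h : IsFrontData A B S D c) : ∃ φ : ℝ → ℝ,
    IsOddProfile φ ∧ 0 < φ 1 ∧ ContDiff ℝ 2 φ ∧
      ∀ x, deriv (deriv φ) x = frontDiffRhs A B S D c (φ x, 0) := by
  have hA := h.A_pos
  have hD := h.D_pos
  have hgap : 0 < A ^ 2 - B ^ 2 := sub_pos.2 (sq_lt_sq.2 (h.abs_B_lt.trans_le (le_abs_self A)))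
  obtain ⟨θ, hθ, hθ_sq⟩ : ∃ θ > 0, A ^ 2 * θ ^ 2 = A ^ 2 - B ^ 2 :=
    ⟨√((A ^ 2 - B ^ 2) / A ^ 2), by positivity, by
      rw [Real.sq_sqrt (by positivity), mul_div_cancel₀ _ (by positivity)]⟩
  have hθ₁ : θ ≤ 1 := by
    refine (sq_le_one_iff₀ hθ.le).1 (le_of_mul_le_mul_left ?_ (pow_pos hA 2))
    linarith [sq_nonneg B]
  obtain ⟨k, hk, hk_sq⟩ : ∃ k > 0, 2 * k ^ 2 = A * D ^ 2 * θ ^ 2 :=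
    ⟨√(A * D ^ 2 * θ ^ 2 / 2), by positivity, by
      rw [Real.sq_sqrt (by positivity), mul_div_cancel₀ _ two_ne_zero]⟩
  have hfrontDiff (φ : ℝ) :
      frontDiffRhs A B S D c (φ, 0) = A * D ^ 2 * φ * (φ ^ 2 - θ ^ 2) := by
    refine mul_left_cancel₀ hA.ne' ?_
    simp only [frontDiffRhs, frontSum]
    linear_combination φ * B * h.c_eq + D ^ 2 * φ * hθ_sq
  obtain ⟨hφ, hφ''⟩ := contDiff_two_const_mul_tanh_mul θ k
  refine ⟨_, .const_mul_tanh_mul hθ.le hθ₁ hk.le, ?_, hφ, fun x => ?_⟩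
  · rw [mul_one, Real.tanh_eq_sinh_div_cosh]
    exact mul_pos hθ (div_pos (Real.sinh_pos_iff.2 hk) (Real.cosh_pos k))
  · rw [hφ'', hfrontDiff, hk_sq]
    ring

theorem constraint_step (h : IsFrontData A B S D c) {κ : ℝ} (hκ : 0 < κ)
    (hκ_sq : 4 * A * (c + S) ^ 2 ≤ κ ^ 2) {τ σ : ℝ} (hmem : (τ, σ) ∈ Set.Icc (0 : ℝ × ℝ) 1)
    (hle : D * τ ≤ frontSum c S σ) :
    D * (τ - frontDiffRhs A B S D c (τ, σ) / κ ^ 2) ≤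
      frontSum c S (σ - frontSumRhs A S c (τ, σ) / κ ^ 2) := by
  have hσ : σ ∈ Set.Icc (0 : ℝ) 1 := ⟨hmem.1.2, hmem.2.2⟩
  have hmode := modeRhs_sub_modeRhs_le h.abs_B_lt.le
    (pow_le_pow_left₀ h.D_pos.le h.D_lt_S.le 2) (mul_nonneg h.D_pos.le hmem.1.1) hle
  have hκ_mul : 4 * A * frontSum c S σ ^ 2 * (frontSum c S σ - D * τ) ≤
      κ ^ 2 * (frontSum c S σ - D * τ) := by
    refine mul_le_mul_of_nonneg_right (le_trans ?_ hκ_sq) (sub_nonneg.2 hle)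
    exact mul_le_mul_of_nonneg_left
      (pow_le_pow_left₀ (h.frontSum_pos hσ).le (h.frontSum_le_add hσ) 2)
      (mul_nonneg zero_le_four h.A_pos.le)
  rw [← h.mul_frontSumRhs, ← mul_frontDiffRhs] at hmode
  refine le_of_mul_le_mul_left ?_ (pow_pos hκ 2)
  have hdiff : κ ^ 2 * (D * (τ - frontDiffRhs A B S D c (τ, σ) / κ ^ 2)) =
      κ ^ 2 * (D * τ) - D * frontDiffRhs A B S D c (τ, σ) := by
    field_simp
  have hsum : κ ^ 2 * frontSum c S (σ - frontSumRhs A S c (τ, σ) / κ ^ 2) =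
      κ ^ 2 * frontSum c S σ - (S - c) * frontSumRhs A S c (τ, σ) := by
    simp only [frontSum]
    field_simp
    ring
  rw [hdiff, hsum]
  linarith

end IsFrontData

/-- A front `(s, d)` of the mode system from `(S, -D)` to `(S, D)`, with `s` even and `d` odd. -/
structure IsSymmetricFront (A B S D : ℝ) (s d : ℝ → ℝ) : Prop where
  contDiff_sum : ContDiff ℝ 2 s
  contDiff_diff : ContDiff ℝ 2 d
  eq_sum : ∀ x, deriv (deriv s) x = modeRhs A B S D (s x) (d x)
  eq_diff : ∀ x, deriv (deriv d) x = modeRhs A B D S (d x) (s x)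
  sum_neg : ∀ x, s (-x) = s x
  diff_neg : ∀ x, d (-x) = -d x
  sum_pos : ∀ x, 0 < s x
  diff_le_sum : ∀ x, d x ≤ s x
  tendsto_sum : Tendsto s atTop (𝓝 S)
  tendsto_diff : Tendsto d atTop (𝓝 D)

/-- The rescaled profiles of a symmetric front: an odd `τ` for the difference and an even `σ` for
the sum. -/
structure IsFrontProfile (A B S D c : ℝ) (τ σ : ℝ → ℝ) : Prop where
  odd : IsOddProfile τ
  even : IsEvenProfile σ
  contDiff_fst : ContDiff ℝ 2 τ
  contDiff_snd : ContDiff ℝ 2 σ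
  eq_fst : ∀ x, deriv (deriv τ) x = frontDiffRhs A B S D c (τ x, σ x)
  eq_snd : ∀ x, deriv (deriv σ) x = frontSumRhs A S c (τ x, σ x)
  le_frontSum : ∀ x, D * τ x ≤ frontSum c S (σ x)
  exists_limit : ∃ t > 0, ∃ s ∈ Set.Icc (0 : ℝ) 1, Tendsto τ atTop (𝓝 t) ∧
    Tendsto σ atTop (𝓝 s) ∧ frontDiffRhs A B S D c (t, s) = 0 ∧ frontSumRhs A S c (t, s) = 0

namespace IsFrontData

variable {A B S D c : ℝ}

theorem exists_isFrontProfile (h : IsFrontData A B S D c) :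
    ∃ τ σ : ℝ → ℝ, IsFrontProfile A B S D c τ σ := by
  obtain ⟨κ, hκ, hκ_sq, H⟩ := h.exists_isCooperativePair
  obtain ⟨φ, hφ, hφ_pos, hφ₂, hφ_eq⟩ := h.exists_isOddProfile_eq_frontDiffRhs
  have hcancel (x y : ℝ) : κ ^ 2 * (x - (x - y / κ ^ 2)) = y := by
    rw [sub_sub_cancel, mul_div_cancel₀ _ (pow_pos hκ 2).ne']
  have hzero {x y : ℝ} (hxy : x = x - y / κ ^ 2) : y = 0 := by
    rw [← hcancel x y, ← hxy, sub_self, mul_zero]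
  have hφ_comp := H.isOddProfile_comp hφ (.const le_rfl zero_le_one)
  have hsub (x : ℝ) (_ : 0 ≤ x) :=
    le_greenOp_of_le_deriv_deriv hκ
      (H.continuous_fst.comp (hφ₂.continuous.prodMk continuous_const)) hφ_comp.abs_le_one hφ₂
      hφ.le_one (fun y => ((hcancel _ _).trans (hφ_eq y).symm).le) x
  obtain ⟨τ, σ, hτ, hσ, hle, hφτ, hτ_eq, hσ_eq⟩ := H.exists_fixed_profile hκ h.D_pos.le
    (h.D_lt_S.le.trans_eq (add_sub_cancel c S).symm)
    (fun t s => h.constraint_step hκ hκ_sq) hφ hsub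
  obtain ⟨⟨hτ₂, hτ''⟩, hσ₂, hσ''⟩ := H.contDiff_two_of_eq_greenOp hκ hτ hσ hτ_eq hσ_eq
  obtain ⟨t, ht, hτt⟩ := hτ.exists_tendsto_atTop
  obtain ⟨s, hs, hσs⟩ := hσ.exists_tendsto_atTop
  obtain ⟨ht_eq, hs_eq⟩ := H.eq_of_tendsto_of_eq_greenOp hκ hτ hσ hτ_eq hσ_eq ht hσs
  refine ⟨τ, σ, hτ, hσ, hτ₂, hσ₂, fun x => (hτ'' x).trans (hcancel _ _),
    fun x => (hσ'' x).trans (hcancel _ _), hle, t, ?_, s, hs, ht, hσs, hzero ht_eq, hzero hs_eq⟩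
  exact hφ_pos.trans_le ((hφτ 1 zero_le_one).trans (hτt 1))

end IsFrontData

theorem IsFrontProfile.isSymmetricFront {A B S D c : ℝ} {τ σ : ℝ → ℝ}
    (hprofile : IsFrontProfile A B S D c τ σ) (h : IsFrontData A B S D c) :
    IsSymmetricFront A B S D (fun x => frontSum c S (σ x)) fun x => D * τ x := by
  obtain ⟨t, ht, s, hs, hτt, hσs, hdiff_zero, hsum_zero⟩ := hprofile.exists_limit
  obtain ⟨hsS, htD⟩ : frontSum c S s = S ∧ D * t = D :=
    eq_of_modeRhs_eq_zero h.abs_B_lt h.S_pos h.D_pos (h.frontSum_pos hs) (mul_pos h.D_pos ht)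
      (by rw [← h.mul_frontSumRhs, hsum_zero, mul_zero])
      (by rw [← mul_frontDiffRhs, hdiff_zero, mul_zero])
  have hτ := hprofile.odd
  have hσ := hprofile.even
  exact
  { contDiff_sum := contDiff_const.add (contDiff_const.mul hprofile.contDiff_snd)
    contDiff_diff := contDiff_const.mul hprofile.contDiff_fst
    eq_sum := fun x => by
      simp only [frontSum, deriv_const_add', deriv_const_mul_field']
      rw [hprofile.eq_snd, h.mul_frontSumRhs, frontSum]
    eq_diff := fun x => by
      simp only [deriv_const_mul_field']
      rw [hprofile.eq_fst, mul_frontDiffRhs]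
    sum_neg := fun x => by rw [hσ.map_neg]
    diff_neg := fun x => by rw [hτ.map_neg, mul_neg]
    sum_pos := fun x => h.frontSum_pos ⟨hσ.nonneg x, hσ.le_one x⟩
    diff_le_sum := hprofile.le_frontSum
    tendsto_sum := by
      have hlim : Tendsto (fun x => frontSum c S (σ x)) atTop (𝓝 (frontSum c S s)) :=
        (hσs.const_mul (S - c)).const_add c
      rwa [hsS] at hlim
    tendsto_diff := by
      have hlim := hτt.const_mul D
      rwa [htD] at hlim }

end FrontData

theorem exists_isSymmetricFront {A B S D : ℝ} (hAB : |B| < A) (hD : 0 < D) (hDS : D < S) :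
    ∃ s d : ℝ → ℝ, IsSymmetricFront A B S D s d := by
  obtain ⟨c, h⟩ := exists_isFrontData hAB hD hDS
  obtain ⟨τ, σ, hprofile⟩ := h.exists_isFrontProfile
  exact ⟨_, _, hprofile.isSymmetricFront h⟩

theorem pos_of_nonneg_of_eq_rhsF {α ω : ℝ} {u v : ℝ → ℝ} (hω : 0 < ω) (hu : ContDiff ℝ 2 u)
    (hu₀ : ∀ x, 0 ≤ u x) (heq : ∀ x, deriv (deriv u) x = rhsF α ω (u x) (v x))
    (hsum : ∀ x, 0 < u x + v x) (x : ℝ) : 0 < u x := by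
  refine (hu₀ x).lt_of_ne fun hzero => ?_
  have hmin : IsLocalMin u x := Eventually.of_forall fun y => hzero.symm.trans_le (hu₀ y)
  have hu'' := deriv_deriv_nonneg_of_isLocalMin hmin hu.continuous.continuousAt
  have hv := mul_pos (hsum x) hω
  rw [heq, rhsF, ← hzero] at hu''
  rw [← hzero] at hv
  linarith

namespace IsSymmetricFront

variable {α ω a b : ℝ} {s d : ℝ → ℝ}

theorem deriv_deriv_half_add
    (h : IsSymmetricFront ((2 + α) / 4) ((2 - α) / 4) (a + b) (b - a) s d)
    (hw : IsWellPair α ω a b) (x : ℝ) :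
    deriv (deriv fun y => (s y + d y) / 2) x = rhsF α ω ((s x + d x) / 2) ((s x - d x) / 2) := by
  have hadd := hw.rhsF_add_rhsG ((s x + d x) / 2) ((s x - d x) / 2)
  have hsub := hw.rhsF_sub_rhsG ((s x + d x) / 2) ((s x - d x) / 2)
  have hs : (s x + d x) / 2 + (s x - d x) / 2 = s x := by ring
  have hd : (s x + d x) / 2 - (s x - d x) / 2 = d x := by ring
  rw [hs, hd] at hadd hsub
  have hderiv : deriv (fun y => (s y + d y) / 2) = fun y => deriv (fun y => s y + d y) y / 2 :=
    funext fun _ => deriv_div_const 2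
  rw [hderiv, deriv_div_const, deriv_deriv_add h.contDiff_sum h.contDiff_diff, h.eq_sum, h.eq_diff]
  linarith

theorem isPositiveHeteroclinic
    (h : IsSymmetricFront ((2 + α) / 4) ((2 - α) / 4) (a + b) (b - a) s d)
    (hw : IsWellPair α ω a b) :
    IsPositiveHeteroclinic α ω a b (fun x => (s x + d x) / 2) fun x => (s x - d x) / 2 := by
  have hreflect (x : ℝ) : (s x - d x) / 2 = (s (-x) + d (-x)) / 2 := by
    rw [h.sum_neg, h.diff_neg, sub_eq_add_neg]
  have hu : ContDiff ℝ 2 fun x => (s x + d x) / 2 :=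
    (h.contDiff_sum.add h.contDiff_diff).div_const 2
  have heq := h.deriv_deriv_half_add hw
  have hnonneg (x : ℝ) : 0 ≤ (s x + d x) / 2 := by
    have hle := h.diff_le_sum (-x)
    rw [h.diff_neg, h.sum_neg] at hle
    linarith
  have hpos := pos_of_nonneg_of_eq_rhsF hw.omega_pos hu hnonneg heq fun x => by
    linarith [h.sum_pos x]
  have htop : Tendsto (fun x => (s x + d x) / 2) atTop (𝓝 b) := by
    convert (h.tendsto_sum.add h.tendsto_diff).div_const 2 using 2
    ring
  have htop' : Tendsto (fun x => (s x - d x) / 2) atTop (𝓝 a) := by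
    convert (h.tendsto_sum.sub h.tendsto_diff).div_const 2 using 2
    ring
  exact
  { contDiff_u := hu
    contDiff_v := (h.contDiff_sum.sub h.contDiff_diff).div_const 2
    eq_u := heq
    eq_v := fun x => by
      rw [funext hreflect, deriv_deriv_comp_neg fun y => (s y + d y) / 2, heq, rhsG_eq_rhsF,
        ← hreflect, h.sum_neg, h.diff_neg, sub_neg_eq_add]
    pos_u := hpos
    pos_v := fun x => (hpos (-x)).trans_eq (hreflect x).symm
    tendsto_u_atBot := by
      refine (htop'.comp tendsto_neg_atBot_atTop).congr fun x => ?_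
      rw [Function.comp_apply, hreflect, neg_neg]
    tendsto_v_atBot :=
      (htop.comp tendsto_neg_atBot_atTop).congr fun x => (hreflect x).symm
    tendsto_u_atTop := htop
    tendsto_v_atTop := htop' }

end IsSymmetricFront

theorem IsWellPair.exists_isPositiveHeteroclinic {α ω a b : ℝ} (hw : IsWellPair α ω a b) :
    ∃ u v : ℝ → ℝ, IsPositiveHeteroclinic α ω a b u v := by
  have hα := hw.alpha_pos
  have hAB : |(2 - α) / 4| < (2 + α) / 4 := abs_lt.2 ⟨by linarith, by linarith⟩
  have hlt : b - a < a + b := by linarith [hw.pos]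
  obtain ⟨s, d, h⟩ := exists_isSymmetricFront hAB (sub_pos.2 hw.lt) hlt
  exact ⟨_, _, h.isPositiveHeteroclinic hw⟩

theorem mainTheorem4 (α ω a b : ℝ) (hω : 0 < ω) (hωα : ω < α / 2)
    (hab_sq : a ^ 2 + b ^ 2 = 1) (hab_mul : a * b = ω / α) (ha : 0 < a) (hab : a < b) :
    (∃ u v : ℝ → ℝ, IsPositiveHeteroclinic α ω a b u v) ∧
    (∀ u v u' v' : ℝ → ℝ,
      IsPositiveHeteroclinic α ω a b u v → IsPositiveHeteroclinic α ω a b u' v' →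
        ∃ T : ℝ, ∀ x : ℝ, u' x = u (x + T) ∧ v' x = v (x + T)) ∧
    (∀ u v : ℝ → ℝ, IsPositiveHeteroclinic α ω a b u v →
      ∀ x : ℝ, 0 < deriv u x ∧ deriv v x < 0) := by
  have hα : α ≠ 0 := by linarith
  have hw : IsWellPair α ω a b :=
    ⟨hω, hab_sq, by rw [hab_mul, mul_div_cancel₀ _ hα], ha, hab⟩
  refine ⟨hw.exists_isPositiveHeteroclinic, fun u v u' v' h h' => ?_, fun u v h x =>
    ⟨h.deriv_u_pos hw x, h.deriv_v_neg hw x⟩⟩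
  obtain ⟨T, -, hu, hv⟩ := h.exists_eq_translate h' hw
  exact ⟨T, fun x => ⟨hu x, hv x⟩⟩
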